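/- For $k\in\mathbb R$ let $\langle k\rangle=(1+k^2)^{1/2}$. For $\sigma,b\in\mathbb R$ let $\|f\|_{H^\sigma}=\|\langle k\rangle^\sigma\widehat f(k)\|_{L^2_k}$ for functions on $\mathbb R$, and let $$\|u\|_{X^{\sigma,b}}=\big\|\langle \omega+k^2\rangle^{b}\langle k\rangle^{\sigma}\,\widehat u(\omega,k)\big\|_{L^2_{\omega,k}}$$ be the norm of the Bourgain space of the operator $i\partial_t+\partial_x^2$ on $\mathbb R_t\times\mathbb R_x$, where $\widehat u$ is the space-time Fourier transform. Let $s>\frac13$ and $a<\min(3s-1,\frac12)$. **(1) Quintilinear estimate.** There is $\delta_0=\delta_0(s,a)>0$ such that for all $0<\delta<\delta_0$ and all $\varepsilon>0$ there is a constant $C=C(s,a,\delta,\varepsilon)$ such that for every $u\in X^{s,\frac12+\varepsilon}$ (which lies in $L^2(\mathbb R^2)$) the function $|u|^4u$ is in $L^1(\mathbb R^2)$ and $$\big\||u|^4u\big\|_{X^{s+a,-\frac12+\delta}}\le C\,\|u\|_{X^{s,\frac12+\varepsilon}}^5 .$$ **(2) Nonlinear smoothing.** For all $\varepsilon>0$ and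 $T>0$ there is a constant $C=C(s,a,\varepsilon,T)$ such that the following holds for $\mu=\pm1$. Let $u_0\in H^s(\mathbb R)$, and let $u$ be a solution on $[0,T]$, in the sense of Duhamel's formula, of the quintic Schrödinger equation $$iu_t+u_{xx}=\mu|u|^4u,\qquad u(0)=u_0,$$ which agrees on $[0,T]$ with some $v\in X^{s,\frac12+\varepsilon}$. Then $u(t)-e^{it\partial_x^2}u_0$ belongs to $C([0,T];H^{s+a}(\mathbb R))$ and $$\sup_{0\le t\le T}\big\|u(t)-e^{it\partial_x^2}u_0\big\|_{H^{s+a}}\le C\,\|v\|_{X^{s,\frac12+\varepsilon}}^5 .$$ In particular, for $s\ge\frac12$ the nonlinear part of the solution gains any number $a<\frac12$ of derivatives. -/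

import Mathlib

open MeasureTheory Filter Topology FourierTransform
open scoped ENNReal NNReal SchwartzMap

noncomputable section

namespace QuinticNLS

/-- Space-time `ℝ_t × ℝ_x` with the Euclidean inner product; a point is `(t, x)`, and a point of
the dual space is `(τ, ξ)`. -/
abbrev SpaceTime : Type := WithLp 2 (ℝ × ℝ)

/-- The Japanese bracket `⟨y⟩ = (1 + y²)^{1/2}`. -/
def japaneseBracket (y : ℝ) : ℝ := Real.sqrt (1 + y ^ 2)

section Weighted

variable {E : Type*} [NormedAddCommGroup E] [InnerProductSpace ℝ E] [FiniteDimensional ℝ E]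
  [MeasurableSpace E] [BorelSpace E]

/-- The Fourier transform of the tempered distribution `S` is (given by) the function `f`. -/
def HasFourierTransform (S : 𝓢'(E, ℂ)) (f : E → ℂ) : Prop :=
  AEStronglyMeasurable f volume ∧
    ∀ φ : 𝓢(E, ℂ), Integrable (fun ζ => f ζ * φ ζ) volume ∧ (𝓕 S) φ = ∫ ζ, f ζ * φ ζ

/-- `‖w · Ŝ‖_{L²}`. It is `∞` if `Ŝ` is not a function; the function `Ŝ` is unique up to
null sets, so that the infimum is over a single value. -/
def weightedFourierNorm (w : E → ℝ) (S : 𝓢'(E, ℂ)) : ℝ≥0∞ :=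
  ⨅ (f : E → ℂ) (_ : HasFourierTransform S f), eLpNorm (fun ζ => (w ζ : ℂ) * f ζ) 2 volume

end Weighted

/-- The norm of `H^s(ℝ)`, `‖⟨k⟩^s f̂‖_{L²}`. Mathlib's Fourier transform has the kernel
`e^{-2πi x ξ}`, so that the angular frequency is `k = 2πξ`. -/
def sobolevNorm (s : ℝ) (S : 𝓢'(ℝ, ℂ)) : ℝ≥0∞ :=
  weightedFourierNorm (fun ξ => japaneseBracket (2 * Real.pi * ξ) ^ s) S

/-- The norm of the Bourgain space `X^{s,b}` of the operator `i∂_t + ∂_x²`, which is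
`‖⟨ω + k²⟩^b ⟨k⟩^s û‖_{L²}` with the angular frequencies `ω = 2πτ` and `k = 2πξ`. -/
def bourgainNorm (s b : ℝ) (S : 𝓢'(SpaceTime, ℂ)) : ℝ≥0∞ :=
  weightedFourierNorm
    (fun ζ => japaneseBracket (2 * Real.pi * ζ.fst + (2 * Real.pi * ζ.snd) ^ 2) ^ b *
      japaneseBracket (2 * Real.pi * ζ.snd) ^ s) S

/-- The quintic nonlinearity `|z|⁴ z`. -/
def quintic (z : ℂ) : ℂ := (‖z‖ : ℂ) ^ 4 * z

/-- The symbol `e^{-itk²}`, `k = 2πξ`, of the free propagator `e^{it∂_x²}`. -/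
def freeSymbol (t ξ : ℝ) : ℂ :=
  Complex.exp (((-(t * (2 * Real.pi * ξ) ^ 2) : ℝ) : ℂ) * Complex.I)

theorem memLp_freeSymbol_mul (t : ℝ) (g : Lp ℂ 2 (volume : Measure ℝ)) :
    MemLp (fun ξ => freeSymbol t ξ * g ξ) 2 volume := by
  refine (Lp.memLp g).of_le ?_ (Eventually.of_forall fun ξ => ?_)
  · refine AEStronglyMeasurable.mul ?_ (Lp.aestronglyMeasurable g)
    refine Continuous.aestronglyMeasurable ?_
    unfold freeSymbol
    fun_prop
  · rw [norm_mul, freeSymbol, Complex.norm_exp_ofReal_mul_I, one_mul]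

/-- The free evolution `e^{it∂_x²} f` of `f ∈ L²(ℝ)`. -/
def freeEvolution (t : ℝ) (f : Lp ℂ 2 (volume : Measure ℝ)) : Lp ℂ 2 (volume : Measure ℝ) :=
  𝓕⁻ ((memLp_freeSymbol_mul t (𝓕 f)).toLp _)

/-- The curve `u` in `L²(ℝ)` solves `i u_t + u_xx = μ |u|⁴ u`, `u(0) = u₀`, on `[0, T]`, in the sense
of Duhamel's formula
`u(t) = e^{it∂_x²} u₀ - i μ ∫₀ᵗ e^{i(t-t')∂_x²} (|u|⁴u)(t') dt'`,
which is read on the Fourier side; the nonlinearity is in `L¹(ℝ)` at almost every time, and the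
integral in `t'` converges absolutely. -/
structure IsMildSolution (μ T : ℝ) (u₀ : Lp ℂ 2 (volume : Measure ℝ))
    (u : ℝ → Lp ℂ 2 (volume : Measure ℝ)) : Prop where
  integrable : ∀ᵐ t, t ∈ Set.Icc 0 T → Integrable (fun x => quintic (u t x)) volume
  intervalIntegrable : ∀ t ∈ Set.Icc 0 T, ∀ᵐ ξ, IntervalIntegrable
    (fun t' => freeSymbol (t - t') ξ * (𝓕 (fun x => quintic (u t' x)) : ℝ → ℂ) ξ) volume 0 t
  duhamel : ∀ t ∈ Set.Icc 0 T, ∀ᵐ ξ,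
    (𝓕 (u t) : Lp ℂ 2 (volume : Measure ℝ)) ξ =
      freeSymbol t ξ * (𝓕 u₀ : Lp ℂ 2 (volume : Measure ℝ)) ξ -
        Complex.I * (μ : ℂ) *
          ∫ t' in (0 : ℝ)..t, freeSymbol (t - t') ξ * (𝓕 (fun x => quintic (u t' x)) : ℝ → ℂ) ξ

/-- The curve `u` agrees on `[0, T]` with the function `v` on space-time. -/
def AgreesOn (T : ℝ) (u : ℝ → Lp ℂ 2 (volume : Measure ℝ))
    (v : Lp ℂ 2 (volume : Measure SpaceTime)) : Prop :=
  ∀ᵐ t, t ∈ Set.Icc 0 T → ∀ᵐ x, u t x = v (WithLp.toLp 2 (t, x))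

end QuinticNLS

end

/-! By duality, the quintilinear estimate is a bound for an integral over five space-time
frequencies. The dual function is evaluated at their sum, with spatial output bracket `R`, and
carries the weight `⟨k⟩^{s+a}⟨σ⟩^{-p/2}`, `p = 1 - 2δ`. Each of the five factors carries
`⟨k⟩^{-s}⟨σ⟩^{-q/2}`, `q = 1 + 2ε`. Only absolute values of Fourier transforms enter, and a complex
conjugate amounts to reversing the sign of `ω` in the modulation.

Let `B₀ ≤ B₁ ≤ B₂ ≤ B₃ ≤ B₄` be the brackets of the five spatial frequencies. Since `R ≤ 5 B₄`, the
weights can be redistributed (`rpow_weight_le`) so that the factors at `B₁` and `B₂` each have decay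
of order `3s/2`. What remains of the output weight is `1`, or `R^a` when `B₀` is much smaller than
`R`. As `3s/2 > 1/2`, the factors at `B₁` and `B₂` have integrable Fourier transforms; this is where
`s > 1/3` is decisive. The factors at `B₃` and `B₄` are multiplied in `L²` by the bilinear estimate
`lintegral_sq_lconvolution_weighted_le`. The factor at `B₀` is paired with the dual function. When
`B₀ ≪ R` the resonance phase has slope of size `R` in the integration variable, so up to half a
derivative is gained (`lintegral_bracketPow_low_high_le`, `lintegral_sq_gainWeight_le`). This limits
`a` to `a < 1/2`. The redistribution also needs `a ≤ s`, which follows from `a < min (3s - 1)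
(1/2)`.

To transfer this to `|u|⁴u`, the product is written as `(u u ū)(u ū)` with both factors in `L²`. It
is therefore integrable, and its Fourier transform is bounded pointwise by a fivefold convolution.

For the smoothing, Duhamel's formula says that the nonlinear part is, up to a unimodular factor, a
time primitive of the interaction profile `e^{itk²} F̂(t)`. The Fourier transform in time of the
profile is the space-time transform of `F`, with modulation as dual variable. A primitive over
`[0,t]` costs `⟨ω⟩^{-1}`, and Cauchy–Schwarz against `⟨ω⟩^{-1/2-δ}` leaves the `X^{s+a,-1/2+δ}`
norm. The same majorant gives continuity by dominated convergence. -/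

noncomputable section

namespace QuinticNLS

/-! ### Fourier transforms of functions and of tempered distributions -/

section FourierGlue

variable {E : Type*} [NormedAddCommGroup E] [InnerProductSpace ℝ E] [FiniteDimensional ℝ E]
  [MeasurableSpace E] [BorelSpace E]

/-- Any compact set lies in a ball on which some Schwartz bump function equals one; testing against
that bump gives integrability on the set. -/
theorem locallyIntegrable_of_integrable_mul_schwartz {f : E → ℂ}
    (hf : ∀ φ : 𝓢(E, ℂ), Integrable (fun x => f x * φ x) volume) :
    LocallyIntegrable f volume := by
  rw [locallyIntegrable_iff]
  intro K hK
  obtain ⟨R, hR, hKR⟩ : ∃ R : ℝ, 0 < R ∧ K ⊆ Metric.closedBall 0 R := by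
    obtain ⟨R, hR⟩ := hK.isBounded.subset_closedBall 0
    exact ⟨max R 1, by positivity, hR.trans (Metric.closedBall_subset_closedBall (le_max_left _ _))⟩
  let χ : ContDiffBump (0 : E) := ⟨R, R + 1, hR, by linarith⟩
  have h₁ : HasCompactSupport (Complex.ofRealCLM ∘ χ) := χ.hasCompactSupport.comp_left rfl
  have h₂ : ContDiff ℝ (⊤ : ℕ∞) (Complex.ofRealCLM ∘ χ) :=
    Complex.ofRealCLM.contDiff.comp χ.contDiff
  refine ((hf (h₁.toSchwartzMap h₂)).integrableOn (s := K)).congr_fun (fun x hx => ?_)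
    hK.measurableSet
  simp [χ.one_of_mem_closedBall (hKR hx)]

/-- A function is determined by its integrals against Schwartz functions. -/
theorem ae_eq_of_integral_mul_schwartz_eq {f g : E → ℂ}
    (hf : ∀ φ : 𝓢(E, ℂ), Integrable (fun x => f x * φ x) volume)
    (hg : ∀ φ : 𝓢(E, ℂ), Integrable (fun x => g x * φ x) volume)
    (h : ∀ φ : 𝓢(E, ℂ), ∫ x, f x * φ x = ∫ x, g x * φ x) : f =ᵐ[volume] g := by
  refine ae_eq_of_integral_contDiff_smul_eq (locallyIntegrable_of_integrable_mul_schwartz hf)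
    (locallyIntegrable_of_integrable_mul_schwartz hg) fun ψ hψ hc => ?_
  have h₁ : HasCompactSupport (Complex.ofRealCLM ∘ ψ) := hc.comp_left rfl
  have h₂ : ContDiff ℝ (⊤ : ℕ∞) (Complex.ofRealCLM ∘ ψ) := Complex.ofRealCLM.contDiff.comp hψ
  simpa [mul_comm] using h (h₁.toSchwartzMap h₂)

theorem integrable_mul_schwartz_of_memLp_two {f : E → ℂ} (hf : MemLp f 2 volume)
    (φ : 𝓢(E, ℂ)) : Integrable (fun x => f x * φ x) volume :=
  hf.integrable_mul (φ.memLp 2 volume)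

theorem integrable_mul_schwartz_of_integrable {f : E → ℂ} (hf : Integrable f volume)
    (φ : 𝓢(E, ℂ)) : Integrable (fun x => f x * φ x) volume :=
  hf.mul_bdd (c := SchwartzMap.seminorm ℝ 0 0 φ) φ.continuous.aestronglyMeasurable
    (Eventually.of_forall fun x => φ.norm_le_seminorm ℝ x)

theorem HasFourierTransform.ae_eq {S : 𝓢'(E, ℂ)} {f g : E → ℂ} (hf : HasFourierTransform S f)
    (hg : HasFourierTransform S g) : f =ᵐ[volume] g :=
  ae_eq_of_integral_mul_schwartz_eq (fun φ => (hf.2 φ).1) (fun φ => (hg.2 φ).1)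
    fun φ => (hf.2 φ).2.symm.trans (hg.2 φ).2

theorem hasFourierTransform_lp_two (u : Lp ℂ 2 (volume : Measure E)) :
    HasFourierTransform (u : 𝓢'(E, ℂ)) (𝓕 u : Lp ℂ 2 (volume : Measure E)) := by
  refine ⟨Lp.aestronglyMeasurable _, fun φ =>
    ⟨integrable_mul_schwartz_of_memLp_two (Lp.memLp _) φ, ?_⟩⟩
  rw [Lp.fourier_toTemperedDistribution_eq, Lp.toTemperedDistribution_apply]
  simp [mul_comm]

theorem integral_lp_two_fourier_mul (u : Lp ℂ 2 (volume : Measure E)) (φ : 𝓢(E, ℂ)) :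
    ∫ x, (𝓕 u : Lp ℂ 2 (volume : Measure E)) x * φ x = ∫ x, u x * 𝓕 φ x := by
  have := ((hasFourierTransform_lp_two u).2 φ).2
  rw [TemperedDistribution.fourier_apply, Lp.toTemperedDistribution_apply] at this
  rw [← this]
  simp [mul_comm]

theorem integral_fourier_mul_schwartz {F : E → ℂ} (hF : Integrable F volume) (φ : 𝓢(E, ℂ)) :
    ∫ x, 𝓕 F x * φ x = ∫ x, F x * 𝓕 φ x := by
  simpa using! VectorFourier.integral_bilin_fourierIntegral_eq_flip (ContinuousLinearMap.mul ℂ ℂ)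
    (L := innerₗ E) Real.continuous_fourierChar continuous_inner hF φ.integrable

theorem continuous_fourier_of_integrable {F : E → ℂ} (hF : Integrable F volume) :
    Continuous (𝓕 F) :=
  VectorFourier.fourierIntegral_continuous Real.continuous_fourierChar
    (innerSL ℝ).continuous₂ hF

theorem norm_fourier_le_integral_norm (F : E → ℂ) (ζ : E) : ‖𝓕 F ζ‖ ≤ ∫ x, ‖F x‖ :=
  VectorFourier.norm_fourierIntegral_le_integral_norm _ _ _ _ _

theorem hasFourierTransform_toLp_one {F : E → ℂ} (hF : MemLp F 1 volume) :
    HasFourierTransform (hF.toLp F : 𝓢'(E, ℂ)) (𝓕 F) := by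
  have hF' := memLp_one_iff_integrable.1 hF
  have hc := continuous_fourier_of_integrable hF'
  refine ⟨hc.aestronglyMeasurable, fun φ => ⟨?_, ?_⟩⟩
  · exact φ.integrable.bdd_mul (c := ∫ x, ‖F x‖) hc.aestronglyMeasurable
      (Eventually.of_forall (norm_fourier_le_integral_norm F))
  · rw [TemperedDistribution.fourier_apply, Lp.toTemperedDistribution_apply,
      integral_fourier_mul_schwartz hF']
    refine integral_congr_ae ?_
    filter_upwards [hF.coeFn_toLp] with x hx
    rw [hx, smul_eq_mul, mul_comm]

/-- The infimum in the definition runs over representatives that agree almost everywhere, so it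
collapses to the value at the Plancherel transform. -/
theorem weightedFourierNorm_lp_two (w : E → ℝ) (u : Lp ℂ 2 (volume : Measure E)) :
    weightedFourierNorm w (u : 𝓢'(E, ℂ)) =
      eLpNorm (fun ζ => (w ζ : ℂ) * (𝓕 u : Lp ℂ 2 (volume : Measure E)) ζ) 2 volume := by
  refine le_antisymm (iInf₂_le _ (hasFourierTransform_lp_two u)) (le_iInf₂ fun f hf => ?_)
  refine le_of_eq (eLpNorm_congr_ae ?_)
  filter_upwards [(hasFourierTransform_lp_two u).ae_eq hf] with ζ hζ
  rw [hζ]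

theorem weightedFourierNorm_toLp_one_le (w : E → ℝ) {F : E → ℂ} (hF : MemLp F 1 volume) :
    weightedFourierNorm w (hF.toLp F : 𝓢'(E, ℂ)) ≤
      eLpNorm (fun ζ => (w ζ : ℂ) * 𝓕 F ζ) 2 volume :=
  iInf₂_le _ (hasFourierTransform_toLp_one hF)

/-- The `L²` Fourier transform is characterised by duality with Schwartz functions. -/
theorem lp_two_fourier_ae_eq {u : Lp ℂ 2 (volume : Measure E)} {g : E → ℂ}
    (hg : MemLp g 2 volume) (h : ∀ φ : 𝓢(E, ℂ), ∫ x, g x * φ x = ∫ x, u x * 𝓕 φ x) :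
    (𝓕 u : Lp ℂ 2 (volume : Measure E)) =ᵐ[volume] g :=
  ae_eq_of_integral_mul_schwartz_eq
    (integrable_mul_schwartz_of_memLp_two (Lp.memLp _))
    (integrable_mul_schwartz_of_memLp_two hg)
    fun φ => (integral_lp_two_fourier_mul u φ).trans (h φ).symm

/-- An integrable function with square integrable Fourier transform is square integrable. -/
theorem memLp_two_of_fourier {F : E → ℂ} (hF : Integrable F volume)
    (hF' : MemLp (𝓕 F) 2 volume) :
    ∃ h : MemLp F 2 volume, (𝓕 (h.toLp F) : Lp ℂ 2 (volume : Measure E)) =ᵐ[volume] 𝓕 F := by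
  set H : Lp ℂ 2 (volume : Measure E) := 𝓕⁻ (hF'.toLp (𝓕 F)) with hH
  have hFH : 𝓕 H = hF'.toLp (𝓕 F) := fourier_fourierInv_eq _
  have hae : H =ᵐ[volume] F := by
    refine ae_eq_of_integral_mul_schwartz_eq
      (integrable_mul_schwartz_of_memLp_two (Lp.memLp _))
      (integrable_mul_schwartz_of_integrable hF) fun φ => ?_
    -- Every test function is itself a Fourier transform, so both pairings can be moved to the
    -- frequency side, where the two transforms coincide.
    obtain ⟨ψ, rfl⟩ : ∃ ψ : 𝓢(E, ℂ), 𝓕 ψ = φ := ⟨𝓕⁻ φ, fourier_fourierInv_eq _⟩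
    rw [← integral_lp_two_fourier_mul, ← integral_fourier_mul_schwartz hF, hFH]
    refine integral_congr_ae ?_
    filter_upwards [hF'.coeFn_toLp] with x hx
    rw [hx]
  have hm : MemLp F 2 volume := (memLp_congr_ae hae).1 (Lp.memLp H)
  have : hm.toLp F = H := by
    rw [← Lp.toLp_coeFn H (Lp.memLp H)]
    exact (MemLp.toLp_eq_toLp_iff _ _).2 hae.symm
  refine ⟨hm, ?_⟩
  rw [this, hFH]
  exact hF'.coeFn_toLp

end FourierGlue

/-! ### Fourier transform of a product of two `L²` functions -/

section FourierProduct

variable {E : Type*} [NormedAddCommGroup E] [InnerProductSpace ℝ E] [FiniteDimensional ℝ E]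
  [MeasurableSpace E] [BorelSpace E]

theorem memLp_two_comp_add_right {f : E → ℂ} (hf : MemLp f 2 volume) (ζ : E) :
    MemLp (fun η => f (η + ζ)) 2 volume :=
  hf.comp_measurePreserving (measurePreserving_add_right volume ζ)

theorem memLp_two_comp_neg {f : E → ℂ} (hf : MemLp f 2 volume) :
    MemLp (fun η => f (-η)) 2 volume :=
  hf.comp_measurePreserving (Measure.measurePreserving_neg volume)

theorem memLp_two_conj {f : E → ℂ} (hf : MemLp f 2 volume) :
    MemLp (fun η => (starRingEnd ℂ) (f η)) 2 volume := by
  refine hf.of_le (Complex.continuous_conj.comp_aestronglyMeasurable hf.1)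
    (Eventually.of_forall fun x => ?_)
  simp

/-- The reflection `x ↦ conj (φ (-x))` of a Schwartz function. -/
def schwartzConjNeg (φ : 𝓢(E, ℂ)) : 𝓢(E, ℂ) :=
  SchwartzMap.postcompCLM (𝕜 := ℝ) (Complex.conjCLE : ℂ →L[ℝ] ℂ)
    (SchwartzMap.compCLMOfContinuousLinearEquiv ℝ (ContinuousLinearEquiv.neg ℝ (M := E)) φ)

omit [FiniteDimensional ℝ E] [MeasurableSpace E] [BorelSpace E] in
theorem schwartzConjNeg_apply (φ : 𝓢(E, ℂ)) (x : E) :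
    schwartzConjNeg φ x = (starRingEnd ℂ) (φ (-x)) := by
  simp [schwartzConjNeg]

theorem fourier_schwartzConjNeg (φ : 𝓢(E, ℂ)) (x : E) :
    𝓕 (schwartzConjNeg φ) x = (starRingEnd ℂ) (𝓕 φ x) := by
  rw [SchwartzMap.fourier_coe, SchwartzMap.fourier_coe, Real.fourier_eq', Real.fourier_eq',
    ← integral_conj, ← integral_neg_eq_self]
  refine integral_congr_ae (Eventually.of_forall fun v => ?_)
  simp only [schwartzConjNeg_apply, neg_neg, smul_eq_mul, map_mul, ← Complex.exp_conj,
    Complex.conj_ofReal, Complex.conj_I, inner_neg_left]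
  congr 2
  push_cast
  ring

theorem fourier_compSubConst (φ : 𝓢(E, ℂ)) (ζ x : E) :
    𝓕 (φ.compSubConstCLM ℝ ζ) x = Complex.exp (((-2 * Real.pi * inner ℝ ζ x : ℝ) : ℂ) * Complex.I) * 𝓕 φ x := by
  rw [SchwartzMap.fourier_coe, SchwartzMap.fourier_coe, Real.fourier_eq', Real.fourier_eq',
    ← integral_const_mul, ← integral_add_right_eq_self _ ζ]
  refine integral_congr_ae (Eventually.of_forall fun v => ?_)
  simp only [SchwartzMap.compSubConstCLM_apply, add_sub_cancel_right, smul_eq_mul, inner_add_left]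
  rw [← mul_assoc, ← Complex.exp_add]
  congr 2
  push_cast
  ring

theorem lp_two_fourier_conj (u : Lp ℂ 2 (volume : Measure E)) :
    (𝓕 ((memLp_two_conj (Lp.memLp u)).toLp _) : Lp ℂ 2 (volume : Measure E)) =ᵐ[volume]
      fun η => (starRingEnd ℂ) ((𝓕 u : Lp ℂ 2 (volume : Measure E)) (-η)) := by
  refine lp_two_fourier_ae_eq (memLp_two_conj (memLp_two_comp_neg (Lp.memLp _))) fun φ => ?_
  have h := congrArg (starRingEnd ℂ) (integral_lp_two_fourier_mul u (schwartzConjNeg φ))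
  simp only [← integral_conj, map_mul, fourier_schwartzConjNeg, schwartzConjNeg_apply,
    Complex.conj_conj] at h
  rw [← integral_neg_eq_self] at h
  simp only [neg_neg] at h
  rw [h]
  refine integral_congr_ae ?_
  filter_upwards [(memLp_two_conj (Lp.memLp u)).coeFn_toLp] with x hx
  rw [hx]

theorem memLp_two_modulate {f : E → ℂ} (hf : MemLp f 2 volume) (ζ : E) :
    MemLp (fun x => Complex.exp (((-2 * Real.pi * inner ℝ ζ x : ℝ) : ℂ) * Complex.I) * f x)
      2 volume := by
  refine hf.of_le ?_ (Eventually.of_forall fun x => ?_)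
  · refine AEStronglyMeasurable.mul (Continuous.aestronglyMeasurable ?_) hf.1
    fun_prop
  · rw [norm_mul, Complex.norm_exp_ofReal_mul_I, one_mul]

theorem lp_two_fourier_modulate (u : Lp ℂ 2 (volume : Measure E)) (ζ : E) :
    (𝓕 ((memLp_two_modulate (Lp.memLp u) ζ).toLp _) : Lp ℂ 2 (volume : Measure E)) =ᵐ[volume]
      fun η => (𝓕 u : Lp ℂ 2 (volume : Measure E)) (η + ζ) := by
  refine lp_two_fourier_ae_eq (memLp_two_comp_add_right (Lp.memLp _) ζ) fun φ => ?_
  have h := integral_lp_two_fourier_mul u (φ.compSubConstCLM ℝ ζ)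
  rw [← integral_add_right_eq_self _ ζ] at h
  simp only [SchwartzMap.compSubConstCLM_apply, add_sub_cancel_right, fourier_compSubConst] at h
  rw [h]
  refine integral_congr_ae ?_
  filter_upwards [(memLp_two_modulate (Lp.memLp u) ζ).coeFn_toLp] with x hx
  rw [hx]
  ring

/-- The Fourier transform of the product of two square integrable functions is the convolution of
their Fourier transforms. -/
theorem fourier_mul_lp_two (p q : Lp ℂ 2 (volume : Measure E)) (ζ : E) :
    𝓕 (fun x => p x * q x) ζ =
      ∫ η, (𝓕 p : Lp ℂ 2 (volume : Measure E)) η *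
        (𝓕 q : Lp ℂ 2 (volume : Measure E)) (ζ - η) := by
  -- Plancherel for the inner product of `conj p` with `q` modulated by `ζ`: in space this inner
  -- product is the Fourier integral of `p q` at `ζ`, in frequency it is the convolution integral up
  -- to `η ↦ -η`.
  have h := Lp.inner_fourier_eq ((memLp_two_conj (Lp.memLp p)).toLp _)
    ((memLp_two_modulate (Lp.memLp q) ζ).toLp _)
  rw [L2.inner_def, L2.inner_def] at h
  have h₁ : ∫ a, inner ℂ (((memLp_two_conj (Lp.memLp p)).toLp _ : Lp ℂ 2 (volume : Measure E)) a)
      (((memLp_two_modulate (Lp.memLp q) ζ).toLp _ : Lp ℂ 2 (volume : Measure E)) a) =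
      𝓕 (fun x => p x * q x) ζ := by
    rw [Real.fourier_eq']
    refine integral_congr_ae ?_
    filter_upwards [(memLp_two_conj (Lp.memLp p)).coeFn_toLp,
      (memLp_two_modulate (Lp.memLp q) ζ).coeFn_toLp] with x hx hx'
    rw [hx, hx']
    simp only [RCLike.inner_apply, Complex.conj_conj, smul_eq_mul, real_inner_comm x ζ]
    ring
  rw [← h₁, ← h, ← integral_neg_eq_self]
  refine integral_congr_ae ?_
  have hn := (Measure.measurePreserving_neg (volume : Measure E)).quasiMeasurePreserving
  filter_upwards [hn.ae_eq_comp (lp_two_fourier_conj p),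
    hn.ae_eq_comp (lp_two_fourier_modulate q ζ)] with x hx hx'
  simp only [Function.comp_apply] at hx hx'
  rw [hx, hx']
  simp only [RCLike.inner_apply, Complex.conj_conj, neg_neg]
  rw [mul_comm, neg_add_eq_sub]

end FourierProduct

/-! ### Cauchy–Schwarz and `L²` duality for nonnegative functions -/

section Lintegral

theorem sq_lintegral_mul_le {α : Type*} [MeasurableSpace α] {μ : Measure α} {f g : α → ℝ≥0∞}
    (hf : AEMeasurable f μ) (hg : AEMeasurable g μ) :
    (∫⁻ x, f x * g x ∂μ) ^ 2 ≤ (∫⁻ x, f x ^ 2 ∂μ) * ∫⁻ x, g x ^ 2 ∂μ := by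
  have h := ENNReal.lintegral_mul_le_Lp_mul_Lq μ Real.HolderConjugate.two_two hf hg
  simp only [Pi.mul_apply, ENNReal.rpow_ofNat] at h
  refine (pow_le_pow_left₀ (zero_le) h 2).trans (le_of_eq ?_)
  rw [mul_pow, ← ENNReal.rpow_natCast, ← ENNReal.rpow_natCast, ← ENNReal.rpow_mul,
    ← ENNReal.rpow_mul]
  norm_num

/-- Duality for `L²` in terms of nonnegative functions. -/
theorem lintegral_sq_le_of_forall_mul {α : Type*} [MeasurableSpace α] {μ : Measure α}
    [SigmaFinite μ] {h : α → ℝ≥0∞} (hh : Measurable h) {C : ℝ≥0∞}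
    (H : ∀ φ : α → ℝ≥0∞, Measurable φ → (∫⁻ x, φ x * h x ∂μ) ^ 2 ≤ C * ∫⁻ x, φ x ^ 2 ∂μ) :
    ∫⁻ x, h x ^ 2 ∂μ ≤ C := by
  -- Truncation in height and to sets of finite measure makes `∫ t²` finite, so that it can be
  -- cancelled after testing with `t` itself.
  set t : ℕ → α → ℝ≥0∞ := fun n => (spanningSets μ n).indicator fun x => min (h x) n with ht
  have htm : ∀ n, Measurable (t n) := fun n =>
    (hh.min measurable_const).indicator (measurableSet_spanningSets μ n)
  have hle : ∀ n x, t n x ≤ h x := fun n x =>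
    Set.indicator_le_self' (fun _ _ => zero_le) x |>.trans (by exact min_le_left _ _)
  have hmono : Monotone t := by
    intro m n hmn x
    refine (Set.indicator_le_indicator_of_subset (monotone_spanningSets μ hmn)
      (fun _ => zero_le) x).trans (Set.indicator_le_indicator ?_)
    exact min_le_min le_rfl (by exact_mod_cast hmn)
  have hlim : ∀ x, Tendsto (fun n => t n x) atTop (𝓝 (h x)) := by
    intro x
    have h1 : Tendsto (fun n : ℕ => min (h x) (n : ℝ≥0∞)) atTop (𝓝 (min (h x) ∞)) :=
      tendsto_const_nhds.min ENNReal.tendsto_nat_nhds_top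
    rw [min_eq_left le_top] at h1
    refine h1.congr' ?_
    filter_upwards [eventually_ge_atTop (spanningSetsIndex μ x)] with n hn
    rw [ht]
    simp only
    rw [Set.indicator_of_mem (monotone_spanningSets μ hn (mem_spanningSetsIndex μ x))]
  have hlim2 : Tendsto (fun n => ∫⁻ x, t n x ^ 2 ∂μ) atTop (𝓝 (∫⁻ x, h x ^ 2 ∂μ)) := by
    refine lintegral_tendsto_of_tendsto_of_monotone (fun n => ((htm n).pow_const 2).aemeasurable)
      (Eventually.of_forall fun x m n hmn => ?_) (Eventually.of_forall fun x => ?_)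
    · exact pow_le_pow_left₀ (zero_le) (hmono hmn x) 2
    · exact (ENNReal.continuous_pow 2).continuousAt.tendsto.comp (hlim x)
  refine le_of_tendsto' hlim2 fun n => ?_
  have hfin : ∫⁻ x, t n x ^ 2 ∂μ ≠ ∞ := by
    have : ∀ x, t n x ^ 2 ≤ (spanningSets μ n).indicator (fun _ => (n : ℝ≥0∞) ^ 2) x := by
      intro x
      by_cases hx : x ∈ spanningSets μ n
      · simp only [ht, Set.indicator_of_mem hx]
        exact pow_le_pow_left₀ (zero_le) (min_le_right _ _) 2
      · simp [ht, Set.indicator_of_notMem hx]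
    refine ((lintegral_mono this).trans_lt ?_).ne
    rw [lintegral_indicator_const (measurableSet_spanningSets μ n)]
    exact ENNReal.mul_lt_top (by simp) (measure_spanningSets_lt_top μ n)
  have h2 : (∫⁻ x, t n x ^ 2 ∂μ) * (∫⁻ x, t n x ^ 2 ∂μ) ≤ C * ∫⁻ x, t n x ^ 2 ∂μ := by
    rw [← sq]
    refine le_trans (pow_le_pow_left₀ (zero_le) (lintegral_mono fun x => ?_) 2) (H _ (htm n))
    rw [sq]
    gcongr
    exact hle n x
  rcases eq_or_ne (∫⁻ x, t n x ^ 2 ∂μ) 0 with h0 | h0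
  · rw [h0]; exact zero_le
  · exact (ENNReal.mul_le_mul_iff_left h0 hfin).1 h2

end Lintegral

/-! ### Convolution inequalities for nonnegative functions -/

section Convolution

variable {E : Type*} [NormedAddCommGroup E] [InnerProductSpace ℝ E] [FiniteDimensional ℝ E]
  [MeasurableSpace E] [BorelSpace E]

/-- Cauchy–Schwarz for bilinear operators with a kernel. -/
theorem lintegral_sq_kernel_le {κ : E → E → ℝ≥0∞} {a f : E → ℝ≥0∞} {C : ℝ≥0∞}
    (hκ : Measurable (Function.uncurry κ)) (ha : Measurable a) (hf : Measurable f)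
    (hC : ∀ y, ∫⁻ x, κ y x ^ 2 ≤ C) :
    ∫⁻ y, (∫⁻ x, κ y x * (a (y + x) * f x)) ^ 2 ≤ C * (∫⁻ x, a x ^ 2) * ∫⁻ x, f x ^ 2 := by
  calc ∫⁻ y, (∫⁻ x, κ y x * (a (y + x) * f x)) ^ 2
      ≤ ∫⁻ y, C * ∫⁻ x, (a (y + x) * f x) ^ 2 := by
        refine lintegral_mono fun y => ?_
        refine (sq_lintegral_mul_le (hκ.of_uncurry_left).aemeasurable ?_).trans ?_
        · fun_prop
        · gcongr
          exact hC y
    _ = C * ∫⁻ y, ∫⁻ x, (a (y + x) * f x) ^ 2 := lintegral_const_mul _ (by fun_prop)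
    _ = C * ∫⁻ x, ∫⁻ y, a (y + x) ^ 2 * f x ^ 2 := by
        rw [lintegral_lintegral_swap (by fun_prop)]
        simp only [mul_pow]
    _ = C * ∫⁻ x, (∫⁻ y, a y ^ 2) * f x ^ 2 := by
        congr 1
        refine lintegral_congr fun x => ?_
        rw [lintegral_mul_const _ (by fun_prop), lintegral_add_right_eq_self (fun y => a y ^ 2) x]
    _ = _ := by rw [lintegral_const_mul _ (by fun_prop), mul_assoc]

theorem lconvolution_eq_sub (f g : E → ℝ≥0∞) (ζ : E) :
    (f ⋆ₗ g) ζ = ∫⁻ y, f (ζ - y) * g y := by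
  rw [lconvolution_def, ← lintegral_sub_left_eq_self _ ζ]
  simp

theorem lconvolution_eq_neg (f g : E → ℝ≥0∞) (ζ : E) :
    (f ⋆ₗ g) ζ = ∫⁻ y, f (-y) * g (ζ + y) := by
  rw [lconvolution_def, ← lintegral_neg_eq_self]
  simp [add_comm]

theorem lintegral_mul_lconvolution {w f g : E → ℝ≥0∞} (hw : Measurable w) (hf : Measurable f)
    (hg : Measurable g) :
    ∫⁻ ζ, w ζ * (f ⋆ₗ g) ζ = ∫⁻ x, f x * ∫⁻ y, g y * w (x + y) := by
  simp only [lconvolution_def]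
  calc ∫⁻ ζ, w ζ * ∫⁻ y, f y * g (-y + ζ)
      = ∫⁻ ζ, ∫⁻ y, w ζ * (f y * g (-y + ζ)) :=
        lintegral_congr fun ζ => (lintegral_const_mul _ (by fun_prop)).symm
    _ = ∫⁻ y, ∫⁻ ζ, w ζ * (f y * g (-y + ζ)) := lintegral_lintegral_swap (by fun_prop)
    _ = ∫⁻ x, f x * ∫⁻ y, g y * w (x + y) := by
        refine lintegral_congr fun x => ?_
        rw [← lintegral_const_mul _ (by fun_prop), ← lintegral_add_left_eq_self _ x]
        refine lintegral_congr fun y => ?_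
        rw [neg_add_cancel_left]
        ring

/-- Expanding the square leaves `f` only through its autocorrelation, which is insensitive to the
sign of `e`. This is what allows a factor to be reflected without changing the `L²` norm. -/
theorem lintegral_sq_lconvolution_aux {f g : E → ℝ≥0∞} (hf : Measurable f) (hg : Measurable g)
    {e : E → E} (he : Measurable e) :
    ∫⁻ ζ, (∫⁻ y, f (ζ + e y) * g y) ^ 2 =
      ∫⁻ c, ∫⁻ d, (∫⁻ ζ, f (ζ + e c) * f (ζ + e d)) * (g c * g d) := by
  calc ∫⁻ ζ, (∫⁻ y, f (ζ + e y) * g y) ^ 2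
      = ∫⁻ ζ, ∫⁻ c, ∫⁻ d, (f (ζ + e c) * f (ζ + e d)) * (g c * g d) := by
        refine lintegral_congr fun ζ => ?_
        rw [sq, ← lintegral_mul_const _ (by fun_prop)]
        refine lintegral_congr fun c => ?_
        rw [← lintegral_const_mul _ (by fun_prop)]
        refine lintegral_congr fun d => ?_
        ring
    _ = ∫⁻ c, ∫⁻ ζ, ∫⁻ d, (f (ζ + e c) * f (ζ + e d)) * (g c * g d) :=
        lintegral_lintegral_swap (by fun_prop)
    _ = ∫⁻ c, ∫⁻ d, ∫⁻ ζ, (f (ζ + e c) * f (ζ + e d)) * (g c * g d) :=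
        lintegral_congr fun c => lintegral_lintegral_swap (by fun_prop)
    _ = _ := by
        refine lintegral_congr fun c => lintegral_congr fun d => ?_
        rw [lintegral_mul_const _ (by fun_prop)]

/-- `‖f * g‖₂ = ‖f * g̃‖₂` for nonnegative `f`, `g`, where `g̃ = g(-·)`. -/
theorem lintegral_sq_lconvolution_neg_right {f g : E → ℝ≥0∞} (hf : Measurable f)
    (hg : Measurable g) :
    ∫⁻ ζ, (f ⋆ₗ fun y => g (-y)) ζ ^ 2 = ∫⁻ ζ, (f ⋆ₗ g) ζ ^ 2 := by
  have h₁ : ∀ ζ, (f ⋆ₗ fun y => g (-y)) ζ = ∫⁻ y, f (ζ + y) * g y := fun ζ => by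
    rw [lconvolution_eq_sub, ← lintegral_neg_eq_self]
    simp
  have h₂ : ∀ ζ, (f ⋆ₗ g) ζ = ∫⁻ y, f (ζ + -y) * g y := fun ζ => by
    rw [lconvolution_eq_sub]
    simp [sub_eq_add_neg]
  simp only [h₁, h₂]
  rw [lintegral_sq_lconvolution_aux hf hg measurable_id',
    lintegral_sq_lconvolution_aux hf hg measurable_neg]
  refine lintegral_congr fun c => lintegral_congr fun d => ?_
  congr 1
  -- The shift by `-c - d` turns `f (ζ + c) f (ζ + d)` into `f (ζ - d) f (ζ - c)`.
  rw [← lintegral_add_right_eq_self _ (-c + -d)]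
  refine lintegral_congr fun ζ => ?_
  rw [mul_comm]
  congr 2 <;> abel

theorem lintegral_sq_lconvolution_neg_left {f g : E → ℝ≥0∞} (hf : Measurable f)
    (hg : Measurable g) :
    ∫⁻ ζ, ((fun y => f (-y)) ⋆ₗ g) ζ ^ 2 = ∫⁻ ζ, (f ⋆ₗ g) ζ ^ 2 := by
  rw [lconvolution_comm, lintegral_sq_lconvolution_neg_right hg hf, lconvolution_comm]

/-- Young's inequality `‖f * g‖₂ ≤ ‖f‖₁ ‖g‖₂` for nonnegative functions. -/
theorem lintegral_sq_lconvolution_le {f g : E → ℝ≥0∞} (hf : Measurable f) (hg : Measurable g) :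
    ∫⁻ ζ, (f ⋆ₗ g) ζ ^ 2 ≤ (∫⁻ x, f x) ^ 2 * ∫⁻ x, g x ^ 2 := by
  have hs : ∀ x, f x ^ (1 / 2 : ℝ) * f x ^ (1 / 2 : ℝ) = f x := fun x => by
    rw [← ENNReal.rpow_add_of_nonneg _ _ (by norm_num) (by norm_num)]
    norm_num
  calc ∫⁻ ζ, (f ⋆ₗ g) ζ ^ 2 ≤ ∫⁻ ζ, (∫⁻ y, f y) * ∫⁻ y, f y * g (-y + ζ) ^ 2 := by
        refine lintegral_mono fun ζ => ?_
        rw [lconvolution_def]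
        -- Cauchy–Schwarz with respect to the measure `f dy`, expressed by splitting off a square
        -- root of `f`.
        have : ∀ y, f y * g (-y + ζ) = f y ^ (1 / 2 : ℝ) * (f y ^ (1 / 2 : ℝ) * g (-y + ζ)) :=
          fun y => by rw [← mul_assoc, hs]
        simp only [this]
        refine (sq_lintegral_mul_le (by fun_prop) (by fun_prop)).trans (le_of_eq ?_)
        congr 1
        · exact lintegral_congr fun y => by rw [sq, hs]
        · exact lintegral_congr fun y => by rw [mul_pow, sq (f y ^ _), hs]
    _ = (∫⁻ y, f y) * ∫⁻ y, ∫⁻ ζ, f y * g (-y + ζ) ^ 2 := by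
        rw [lintegral_const_mul _ (by fun_prop), lintegral_lintegral_swap (by fun_prop)]
    _ = (∫⁻ y, f y) * ∫⁻ y, f y * ∫⁻ ζ, g ζ ^ 2 := by
        congr 1
        refine lintegral_congr fun y => ?_
        rw [lintegral_const_mul _ (by fun_prop),
          lintegral_add_left_eq_self (fun ζ => g ζ ^ 2) (-y)]
    _ = _ := by rw [lintegral_mul_const _ hf, sq, mul_assoc]

end Convolution

/-! ### Japanese brackets and their powers -/

section Bracket

theorem one_le_japaneseBracket (y : ℝ) : 1 ≤ japaneseBracket y :=
  Real.one_le_sqrt.2 (by nlinarith [sq_nonneg y])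

theorem japaneseBracket_pos (y : ℝ) : 0 < japaneseBracket y :=
  one_pos.trans_le (one_le_japaneseBracket y)

theorem japaneseBracket_sq (y : ℝ) : japaneseBracket y ^ 2 = 1 + y ^ 2 :=
  Real.sq_sqrt (by positivity)

theorem japaneseBracket_neg (y : ℝ) : japaneseBracket (-y) = japaneseBracket y := by
  simp [japaneseBracket]

theorem japaneseBracket_le_of_abs_le {x y : ℝ} (h : |x| ≤ |y|) :
    japaneseBracket x ≤ japaneseBracket y :=
  Real.sqrt_le_sqrt (by linarith [sq_le_sq.2 h])

theorem abs_le_japaneseBracket (y : ℝ) : |y| ≤ japaneseBracket y :=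
  Real.abs_le_sqrt (by linarith)

theorem japaneseBracket_le_one_add_abs (y : ℝ) : japaneseBracket y ≤ 1 + |y| := by
  refine Real.sqrt_le_iff.2 ⟨by positivity, ?_⟩
  nlinarith [abs_nonneg y, sq_abs y]

theorem japaneseBracket_add_le (x y : ℝ) :
    japaneseBracket (x + y) ≤ japaneseBracket x + japaneseBracket y := by
  have hx := abs_le_japaneseBracket x
  have hy := abs_le_japaneseBracket y
  refine Real.sqrt_le_iff.2 ⟨by linarith [abs_nonneg x, abs_nonneg y], ?_⟩
  have h1 : x * y ≤ japaneseBracket x * japaneseBracket y :=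
    (le_abs_self _).trans ((abs_mul x y).le.trans
      (mul_le_mul hx hy (abs_nonneg _) (japaneseBracket_pos x).le))
  nlinarith [japaneseBracket_sq x, japaneseBracket_sq y]

theorem japaneseBracket_sub_le (x y : ℝ) :
    japaneseBracket (x - y) ≤ japaneseBracket x + japaneseBracket y := by
  rw [sub_eq_add_neg, ← japaneseBracket_neg y]
  exact japaneseBracket_add_le _ _

theorem continuous_japaneseBracket : Continuous japaneseBracket := by
  unfold japaneseBracket
  fun_prop

/-- The power `⟨y⟩^p` as an extended nonnegative number. -/
def bracketPow (p y : ℝ) : ℝ≥0∞ := ENNReal.ofReal (japaneseBracket y ^ p)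

@[fun_prop]
theorem measurable_bracketPow (p : ℝ) : Measurable (bracketPow p) :=
  (continuous_japaneseBracket.measurable.pow_const p).ennreal_ofReal

theorem bracketPow_mul (p q y : ℝ) : bracketPow p y * bracketPow q y = bracketPow (p + q) y := by
  rw [bracketPow, bracketPow, ← ENNReal.ofReal_mul (Real.rpow_nonneg (japaneseBracket_pos y).le _),
    ← Real.rpow_add (japaneseBracket_pos y), bracketPow]

theorem bracketPow_zero (y : ℝ) : bracketPow 0 y = 1 := by simp [bracketPow]

theorem bracketPow_neg_mul_cancel (p y : ℝ) : bracketPow (-p) y * bracketPow p y = 1 := by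
  rw [bracketPow_mul, neg_add_cancel, bracketPow_zero]

theorem bracketPow_sq (p y : ℝ) : bracketPow p y ^ 2 = bracketPow (2 * p) y := by
  rw [sq, bracketPow_mul, two_mul]

theorem bracketPow_mono {p q : ℝ} (h : p ≤ q) (y : ℝ) : bracketPow p y ≤ bracketPow q y :=
  ENNReal.ofReal_le_ofReal (Real.rpow_le_rpow_of_exponent_le (one_le_japaneseBracket y) h)

theorem bracketPow_neg (p y : ℝ) : bracketPow p (-y) = bracketPow p y := by
  rw [bracketPow, japaneseBracket_neg, bracketPow]

theorem bracketPow_eq_enorm (p y : ℝ) : bracketPow p y = ‖((japaneseBracket y ^ p : ℝ) : ℂ)‖ₑ := by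
  rw [bracketPow, ← ofReal_norm, Complex.norm_real, Real.norm_of_nonneg
    (Real.rpow_nonneg (japaneseBracket_pos y).le _)]

end Bracket

/-! ### One-dimensional integrals of bracket powers -/

section BracketIntegrals

theorem lintegral_comp_mul_left (g : ℝ → ℝ≥0∞) (hg : Measurable g) {c : ℝ} (hc : c ≠ 0) :
    ∫⁻ x, g (c * x) = ENNReal.ofReal |c⁻¹| * ∫⁻ x, g x := by
  rw [← lintegral_map (μ := volume) hg (measurable_const_mul c), Real.map_volume_mul_left hc,
    lintegral_smul_measure, smul_eq_mul]

/-- The Jacobian `1 / (2π)` is at most one; discarding it lets all later integrals be taken in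
angular frequencies. -/
theorem lintegral_comp_two_pi_mul_le {g : ℝ → ℝ≥0∞} (hg : Measurable g) :
    ∫⁻ x, g (2 * Real.pi * x) ≤ ∫⁻ x, g x := by
  rw [lintegral_comp_mul_left g hg (by positivity)]
  refine mul_le_of_le_one_left' (ENNReal.ofReal_le_one.2 ?_)
  rw [abs_of_pos (by positivity)]
  exact inv_le_one_of_one_le₀ (by nlinarith [Real.pi_gt_three])

theorem lintegral_bracketPow_lt_top {q : ℝ} (hq : 1 < q) : ∫⁻ x, bracketPow (-q) x < ∞ := by
  have h := (integrable_rpow_neg_one_add_norm_sq (E := ℝ) (μ := volume) (r := q)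
    (by simpa using hq)).lintegral_lt_top
  refine lt_of_le_of_lt (lintegral_mono fun x => le_of_eq ?_) h
  rw [bracketPow, japaneseBracket, Real.sqrt_eq_rpow, ← Real.rpow_mul (by positivity)]
  congr 2
  · rw [Real.norm_eq_abs, sq_abs]
  · ring

/-- Weighted convolution inequality for brackets, pointwise form. -/
theorem rpow_neg_mul_rpow_neg_le {p q X Y D : ℝ} (hp : 0 < p) (hpq : p ≤ q) (hX : 1 ≤ X)
    (hY : 1 ≤ Y) (hD : 1 ≤ D) (h : D ≤ X + Y) :
    X ^ (-p) * Y ^ (-q) ≤ 2 ^ p * D ^ (-p) * (X ^ (-q) + Y ^ (-q)) := by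
  have key : ∀ Z : ℝ, 1 ≤ Z → D ≤ 2 * Z → Z ^ (-p) ≤ 2 ^ p * D ^ (-p) := by
    intro Z hZ h1
    have : (2 * Z) ^ (-p) ≤ D ^ (-p) :=
      Real.rpow_le_rpow_of_nonpos (by linarith) h1 (by linarith)
    rw [Real.mul_rpow (by norm_num) (by linarith)] at this
    calc Z ^ (-p) = 2 ^ p * (2 ^ (-p) * Z ^ (-p)) := by
          rw [← mul_assoc, ← Real.rpow_add (by norm_num)]; simp
      _ ≤ _ := by gcongr
  have hX0 : (0 : ℝ) < X := by linarith
  have hY0 : (0 : ℝ) < Y := by linarith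
  have hD0 : (0 : ℝ) < D := by linarith
  rcases le_total Y X with hYX | hXY
  · calc X ^ (-p) * Y ^ (-q) ≤ 2 ^ p * D ^ (-p) * Y ^ (-q) := by
          gcongr; exact key X hX (by linarith)
      _ ≤ _ := by
          gcongr
          exact le_add_of_nonneg_left (by positivity)
  -- Here `Y` is the larger bracket and takes the factor `D^{-p}`; its surplus decay `Y^{-(q-p)}` is
  -- handed over to the smaller `X`, which then has the integrable exponent `q`.
  · calc X ^ (-p) * Y ^ (-q) = Y ^ (-p) * (X ^ (-p) * Y ^ (-(q - p))) := by
          rw [mul_left_comm, ← Real.rpow_add hY0]; ring_nf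
      _ ≤ Y ^ (-p) * (X ^ (-p) * X ^ (-(q - p))) := by
          have := Real.rpow_le_rpow_of_nonpos hX0 hXY (show -(q - p) ≤ 0 by linarith)
          gcongr
      _ = Y ^ (-p) * X ^ (-q) := by rw [← Real.rpow_add hX0]; ring_nf
      _ ≤ 2 ^ p * D ^ (-p) * X ^ (-q) := by
          gcongr; exact key Y hY (by linarith)
      _ ≤ _ := by
          gcongr
          exact le_add_of_nonneg_right (by positivity)

/-- `∫ ⟨A + x⟩^{-p} ⟨B + e x⟩^{-q} dx ≲ ⟨A - e B⟩^{-p}` for `e = ±1`, `0 < p ≤ q`, `q > 1`. -/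
theorem lintegral_bracketPow_mul_le {p q : ℝ} (hp : 0 < p) (hpq : p ≤ q) (hq : 1 < q) :
    ∃ C : ℝ≥0, ∀ e : ℝ, e ^ 2 = 1 → ∀ A B : ℝ,
      ∫⁻ x, bracketPow (-p) (A + x) * bracketPow (-q) (B + e * x) ≤
        C * bracketPow (-p) (A - e * B) := by
  set I := ∫⁻ x, bracketPow (-q) x with hI
  have hI' : I < ∞ := lintegral_bracketPow_lt_top hq
  refine ⟨(ENNReal.ofReal (2 ^ p) * (I + I)).toNNReal, fun e he A B => ?_⟩
  rw [ENNReal.coe_toNNReal (ENNReal.mul_ne_top ENNReal.ofReal_ne_top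
    (ENNReal.add_ne_top.2 ⟨hI'.ne, hI'.ne⟩))]
  have hpt : ∀ x, bracketPow (-p) (A + x) * bracketPow (-q) (B + e * x) ≤
      ENNReal.ofReal (2 ^ p) * bracketPow (-p) (A - e * B) *
        (bracketPow (-q) (A + x) + bracketPow (-q) (B + e * x)) := by
    intro x
    have hs : japaneseBracket (e * (B + e * x)) = japaneseBracket (B + e * x) := by
      simp only [japaneseBracket, mul_pow, he, one_mul]
    -- As `e² = 1`, the combination `(A + x) - e (B + e x)` no longer depends on `x`.
    have h1 := japaneseBracket_sub_le (A + x) (e * (B + e * x))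
    rw [hs, show A + x - e * (B + e * x) = A - e * B by linear_combination (-x) * he] at h1
    have h2 := rpow_neg_mul_rpow_neg_le hp hpq (one_le_japaneseBracket (A + x))
      (one_le_japaneseBracket (B + e * x)) (one_le_japaneseBracket _) h1
    have hn : ∀ r y : ℝ, 0 ≤ japaneseBracket y ^ r := fun r y =>
      Real.rpow_nonneg (japaneseBracket_pos y).le r
    simp only [bracketPow]
    rw [← ENNReal.ofReal_mul (hn _ _), ← ENNReal.ofReal_mul (by positivity),
      ← ENNReal.ofReal_add (hn _ _) (hn _ _),
      ← ENNReal.ofReal_mul (mul_nonneg (by positivity) (hn _ _))]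
    exact ENNReal.ofReal_le_ofReal h2
  have h1 : ∫⁻ x, bracketPow (-q) (A + x) = I :=
    lintegral_add_left_eq_self (fun x => bracketPow (-q) x) A
  have h2 : ∫⁻ x, bracketPow (-q) (B + e * x) = I := by
    rcases sq_eq_one_iff.1 he with rfl | rfl
    · simp only [one_mul]
      exact lintegral_add_left_eq_self (fun x => bracketPow (-q) x) B
    · simp only [neg_one_mul, ← sub_eq_add_neg]
      exact lintegral_sub_left_eq_self (fun x => bracketPow (-q) x) B
  calc _ ≤ ∫⁻ x, ENNReal.ofReal (2 ^ p) * bracketPow (-p) (A - e * B) *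
        (bracketPow (-q) (A + x) + bracketPow (-q) (B + e * x)) := lintegral_mono hpt
    _ = ENNReal.ofReal (2 ^ p) * bracketPow (-p) (A - e * B) * (I + I) := by
        rw [lintegral_const_mul _ (by fun_prop), lintegral_add_left (by fun_prop), h1, h2]
    _ = _ := by ring

/-- `∫ ⟨c + 2 x²⟩^{-p} dx` is bounded uniformly in `c` for `p > 1/2`. -/
theorem lintegral_bracketPow_quadratic_le {p : ℝ} (hp : 1 / 2 < p) :
    ∃ C : ℝ≥0, ∀ c d : ℝ, ∫⁻ x, bracketPow (-p) (c + 2 * (x + d) ^ 2) ≤ C := by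
  set I := ∫⁻ x, bracketPow (-(2 * p)) x with hI
  have hI' : I < ∞ := lintegral_bracketPow_lt_top (by linarith)
  refine ⟨(ENNReal.ofReal (2 ^ p) * (I + I)).toNNReal, fun c d => ?_⟩
  rw [ENNReal.coe_toNNReal (ENNReal.mul_ne_top ENNReal.ofReal_ne_top
    (ENNReal.add_ne_top.2 ⟨hI'.ne, hI'.ne⟩)),
    lintegral_add_right_eq_self (fun x => bracketPow (-p) (c + 2 * x ^ 2)) d]
  -- For `c ≤ 0` the quadratic factors over its roots `±m`; for `c ≥ 0` the double root `m = 0`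
  -- gives a lower bound. The smaller of `|x - m|`, `|x + m|` then has its square below the product.
  obtain ⟨m, hm⟩ : ∃ m : ℝ, ∀ x, 2 * (|x - m| * |x + m|) ≤ |c + 2 * x ^ 2| := by
    rcases le_total 0 c with hc | hc
    · refine ⟨0, fun x => ?_⟩
      rw [sub_zero, add_zero, abs_mul_abs_self, abs_of_nonneg (by positivity)]
      nlinarith
    · refine ⟨Real.sqrt (-c / 2), fun x => le_of_eq ?_⟩
      rw [← abs_mul, ← abs_two, ← abs_mul, abs_two]
      congr 1
      have := Real.sq_sqrt (show 0 ≤ -c / 2 by linarith)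
      linear_combination (-2) * this
  have key : ∀ x y : ℝ, 2 * y ^ 2 ≤ |c + 2 * x ^ 2| →
      bracketPow (-p) (c + 2 * x ^ 2) ≤ ENNReal.ofReal (2 ^ p) * bracketPow (-(2 * p)) y := by
    intro x y hy
    have h1 : japaneseBracket y ^ 2 ≤ 2 * japaneseBracket (c + 2 * x ^ 2) := by
      have h2 : japaneseBracket (2 * y ^ 2) ≤ japaneseBracket (c + 2 * x ^ 2) :=
        japaneseBracket_le_of_abs_le (by rwa [abs_of_nonneg (by positivity)])
      have h3 : japaneseBracket y ^ 2 ≤ 2 * japaneseBracket (2 * y ^ 2) := by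
        refine le_of_sq_le_sq ?_ (mul_pos two_pos (japaneseBracket_pos _)).le
        rw [mul_pow, japaneseBracket_sq, japaneseBracket_sq]
        nlinarith [sq_nonneg (y ^ 2 - 1), sq_nonneg (y ^ 2)]
      linarith
    rw [bracketPow, bracketPow, ← ENNReal.ofReal_mul (by positivity)]
    refine ENNReal.ofReal_le_ofReal ?_
    have h4 : (2 * japaneseBracket (c + 2 * x ^ 2)) ^ (-p) ≤ (japaneseBracket y ^ 2) ^ (-p) :=
      Real.rpow_le_rpow_of_nonpos (pow_pos (japaneseBracket_pos y) 2) h1 (by linarith)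
    rw [Real.mul_rpow (by norm_num) (japaneseBracket_pos _).le,
      ← Real.rpow_natCast (japaneseBracket y), ← Real.rpow_mul (japaneseBracket_pos y).le] at h4
    calc japaneseBracket (c + 2 * x ^ 2) ^ (-p)
        = 2 ^ p * (2 ^ (-p) * japaneseBracket (c + 2 * x ^ 2) ^ (-p)) := by
          rw [← mul_assoc, ← Real.rpow_add (by norm_num)]; simp
      _ ≤ 2 ^ p * japaneseBracket y ^ ((2 : ℕ) * -p) := by gcongr
      _ = _ := by congr 2; push_cast; ring
  have hpt : ∀ x, bracketPow (-p) (c + 2 * x ^ 2) ≤ ENNReal.ofReal (2 ^ p) *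
      (bracketPow (-(2 * p)) (x - m) + bracketPow (-(2 * p)) (x + m)) := by
    intro x
    rcases le_total |x - m| |x + m| with h | h
    · refine (key x (x - m) ((?_ : _ ≤ _).trans (hm x))).trans ?_
      · rw [← sq_abs, sq]; gcongr
      · gcongr; exact le_self_add
    · refine (key x (x + m) ((?_ : _ ≤ _).trans (hm x))).trans ?_
      · rw [← sq_abs, sq]; gcongr
      · gcongr; exact le_add_self
  calc _ ≤ ∫⁻ x, ENNReal.ofReal (2 ^ p) *
      (bracketPow (-(2 * p)) (x - m) + bracketPow (-(2 * p)) (x + m)) := lintegral_mono hpt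
    _ = _ := by
        rw [lintegral_const_mul _ (by fun_prop), lintegral_add_left (by fun_prop),
          lintegral_sub_right_eq_self (fun x => bracketPow (-(2 * p)) x) m,
          lintegral_add_right_eq_self (fun x => bracketPow (-(2 * p)) x) m]

/-- Bound of `∫_S ⟨k + x⟩^{2a} ⟨t + (k + x)² - e x²⟩^{-p} dx` on the set `S` where `⟨x⟩` is much
smaller than `⟨k + x⟩`; the phase has slope at least `|k|` there. -/
theorem lintegral_bracketPow_low_high_le {p q a : ℝ} (hp : 0 < p) (hpq : p ≤ q) (hq : 1 < q)
    (ha : 0 ≤ a) (hapq : 2 * (q - p) + 2 * a ≤ 1) :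
    ∃ C : ℝ≥0, ∀ e : ℝ, e ^ 2 = 1 → ∀ t k : ℝ,
      ∫⁻ x in {x | 20 * japaneseBracket x ≤ japaneseBracket (k + x)},
        bracketPow (2 * a) (k + x) * bracketPow (-p) (t + (k + x) ^ 2 - e * x ^ 2) ≤ C := by
  set I := ∫⁻ x, bracketPow (-q) x with hI
  have hI' : I < ∞ := lintegral_bracketPow_lt_top hq
  refine ⟨(ENNReal.ofReal (3 ^ (2 * a) * (3 ^ p * 2 ^ (q - p))) * I).toNNReal, fun e he t k => ?_⟩
  rw [ENNReal.coe_toNNReal (ENNReal.mul_ne_top ENNReal.ofReal_ne_top hI'.ne)]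
  set S := {x | 20 * japaneseBracket x ≤ japaneseBracket (k + x)} with hS
  have hSm : MeasurableSet S :=
    (isClosed_le (continuous_const.mul continuous_japaneseBracket)
      (continuous_japaneseBracket.comp (by fun_prop))).measurableSet
  set Φ : ℝ → ℝ := fun x => t + (k + x) ^ 2 - e * x ^ 2 with hΦ
  rcases S.eq_empty_or_nonempty with hSe | hSn
  · simp [hSe]
  -- The factor `20` in `S` makes `|x|` a small fraction of `|k|`, so `|k|` is comparable to the
  -- output bracket and cannot be cancelled by `x` in the slope of the phase.
  have hSb : ∀ x ∈ S, 1 ≤ |k| ∧ |x| ≤ |k| / 8 ∧ japaneseBracket (k + x) ≤ 3 * |k| := by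
    intro x hx
    have h1 : 20 * japaneseBracket x ≤ japaneseBracket (k + x) := hx
    have h2 := japaneseBracket_le_one_add_abs (k + x)
    have h3 := abs_add_le k x
    have h4 := abs_le_japaneseBracket x
    have h5 := one_le_japaneseBracket x
    refine ⟨?_, ?_, ?_⟩ <;> linarith
  -- An approximate minimiser of `⟨Φ⟩` on `S` stands in for a zero of the phase, which need not
  -- exist in `S`. With `⟨Φ y⟩ ≤ 2⟨Φ x⟩`, the bracket of `Φ x - Φ y` is at most `3⟨Φ x⟩`.
  obtain ⟨y, hyS, hy⟩ : ∃ y ∈ S, ∀ x ∈ S, japaneseBracket (Φ y) ≤ 2 * japaneseBracket (Φ x) := by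
    set m := sInf ((fun x => japaneseBracket (Φ x)) '' S) with hm
    have hbdd : BddBelow ((fun x => japaneseBracket (Φ x)) '' S) :=
      ⟨1, by rintro _ ⟨x, -, rfl⟩; exact one_le_japaneseBracket _⟩
    have hm1 : 1 ≤ m := le_csInf (hSn.image _) (by rintro _ ⟨x, -, rfl⟩; exact one_le_japaneseBracket _)
    obtain ⟨_, ⟨y, hy, rfl⟩, hlt⟩ := exists_lt_of_csInf_lt (hSn.image _) (show m < 2 * m by linarith)
    refine ⟨y, hy, fun x hx => hlt.le.trans ?_⟩
    have := csInf_le hbdd ⟨x, hx, rfl⟩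
    simp only at this
    linarith
  obtain ⟨hk1, hyk, -⟩ := hSb y hyS
  have hk0 : k ≠ 0 := by
    rintro rfl
    simp at hk1
    linarith
  have hslope : ∀ x ∈ S, |k * (x - y)| ≤ |Φ x - Φ y| := by
    intro x hx
    obtain ⟨-, hxk, -⟩ := hSb x hx
    have h1 : Φ x - Φ y = (x - y) * (2 * k + (1 - e) * (x + y)) := by simp only [hΦ]; ring
    rw [h1, mul_comm, abs_mul, abs_mul]
    refine mul_le_mul_of_nonneg_left ?_ (abs_nonneg _)
    have h2 : |(1 - e) * (x + y)| ≤ 2 * (|k| / 8 + |k| / 8) := by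
      rw [abs_mul]
      gcongr
      · rcases sq_eq_one_iff.1 he with rfl | rfl <;> norm_num
      · exact (abs_add_le x y).trans (by linarith)
    have h3 := abs_sub_abs_le_abs_sub (2 * k) (-((1 - e) * (x + y)))
    rw [abs_neg, sub_neg_eq_add, abs_mul, abs_two] at h3
    linarith
  have hpt : ∀ x ∈ S, bracketPow (2 * a) (k + x) * bracketPow (-p) (Φ x) ≤
      ENNReal.ofReal (3 ^ (2 * a) * (3 ^ p * 2 ^ (q - p)) * |k|) *
        bracketPow (-q) (k * (x - y)) := by
    intro x hx
    obtain ⟨-, hxk, hkx⟩ := hSb x hx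
    set Y := japaneseBracket (k * (x - y)) with hY
    have hY1 : 1 ≤ Y := one_le_japaneseBracket _
    have hYΦ : Y ≤ 3 * japaneseBracket (Φ x) := by
      have := japaneseBracket_le_of_abs_le (hslope x hx)
      have h2 := japaneseBracket_sub_le (Φ x) (Φ y)
      linarith [hy x hx]
    have hYk : Y ≤ 2 * |k| ^ 2 := by
      have h1 := japaneseBracket_le_one_add_abs (k * (x - y))
      rw [abs_mul] at h1
      have h2 : |x - y| ≤ |k| / 4 := (abs_sub x y).trans (by linarith)
      nlinarith [mul_le_mul_of_nonneg_left h2 (abs_nonneg k)]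
    have e1 : japaneseBracket (k + x) ^ (2 * a) ≤ 3 ^ (2 * a) * |k| ^ (2 * a) := by
      rw [← Real.mul_rpow (by norm_num) (abs_nonneg k)]
      exact Real.rpow_le_rpow (japaneseBracket_pos _).le hkx (by linarith)
    have e2 : japaneseBracket (Φ x) ^ (-p) ≤ 3 ^ p * Y ^ (-p) := by
      have h4 : (3 * japaneseBracket (Φ x)) ^ (-p) ≤ Y ^ (-p) :=
        Real.rpow_le_rpow_of_nonpos (by linarith) hYΦ (by linarith)
      rw [Real.mul_rpow (by norm_num) (japaneseBracket_pos _).le] at h4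
      calc japaneseBracket (Φ x) ^ (-p) = 3 ^ p * (3 ^ (-p) * japaneseBracket (Φ x) ^ (-p)) := by
            rw [← mul_assoc, ← Real.rpow_add (by norm_num)]; simp
        _ ≤ _ := by gcongr
    -- The exponent `p` may be below the threshold of integrability. Since `Y ≲ |k|²` on `S`,
    -- raising it to `q > 1` costs only `|k|^{2(q-p)}`.
    have e3 : Y ^ (-p) ≤ 2 ^ (q - p) * |k| ^ (2 * (q - p)) * Y ^ (-q) := by
      have h4 : Y ^ (q - p) ≤ (2 * |k| ^ 2) ^ (q - p) :=
        Real.rpow_le_rpow (by linarith) hYk (by linarith)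
      rw [Real.mul_rpow (by norm_num) (by positivity), ← Real.rpow_natCast |k|,
        ← Real.rpow_mul (abs_nonneg k)] at h4
      calc Y ^ (-p) = Y ^ (q - p) * Y ^ (-q) := by
            rw [← Real.rpow_add (by linarith)]; ring_nf
        _ ≤ _ := by
            gcongr
            exact_mod_cast h4
    -- The gain and the loss together use at most one power of `|k|`, which the substitution `x ↦ k
    -- (x - y)` returns as `|k|⁻¹`.
    have e4 : |k| ^ (2 * a) * |k| ^ (2 * (q - p)) ≤ |k| := by
      rw [← Real.rpow_add (by linarith)]
      exact (Real.rpow_le_rpow_of_exponent_le hk1 (by linarith)).trans (Real.rpow_one _).le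
    rw [bracketPow, bracketPow, bracketPow,
      ← ENNReal.ofReal_mul (Real.rpow_nonneg (japaneseBracket_pos _).le _),
      ← ENNReal.ofReal_mul (by positivity)]
    refine ENNReal.ofReal_le_ofReal ?_
    have hYq : 0 ≤ Y ^ (-q) := Real.rpow_nonneg (by linarith) _
    have hYp : 0 ≤ Y ^ (-p) := Real.rpow_nonneg (by linarith) _
    calc japaneseBracket (k + x) ^ (2 * a) * japaneseBracket (Φ x) ^ (-p)
        ≤ (3 ^ (2 * a) * |k| ^ (2 * a)) *
          (3 ^ p * (2 ^ (q - p) * |k| ^ (2 * (q - p)) * Y ^ (-q))) :=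
          mul_le_mul e1 (e2.trans (by gcongr)) (Real.rpow_nonneg (japaneseBracket_pos _).le _)
            (by positivity)
      _ = 3 ^ (2 * a) * (3 ^ p * 2 ^ (q - p)) * (|k| ^ (2 * a) * |k| ^ (2 * (q - p))) *
          Y ^ (-q) := by ring
      _ ≤ _ := by gcongr
  calc _ ≤ ∫⁻ x in S, ENNReal.ofReal (3 ^ (2 * a) * (3 ^ p * 2 ^ (q - p)) * |k|) *
        bracketPow (-q) (k * (x - y)) := setLIntegral_mono' hSm hpt
    _ ≤ ∫⁻ x, ENNReal.ofReal (3 ^ (2 * a) * (3 ^ p * 2 ^ (q - p)) * |k|) *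
        bracketPow (-q) (k * (x - y)) := setLIntegral_le_lintegral _ _
    _ = ENNReal.ofReal (3 ^ (2 * a) * (3 ^ p * 2 ^ (q - p)) * |k|) *
        (ENNReal.ofReal |k⁻¹| * I) := by
        rw [lintegral_const_mul _ (by fun_prop),
          lintegral_sub_right_eq_self (fun x => bracketPow (-q) (k * x)) y,
          lintegral_comp_mul_left _ (by fun_prop) hk0]
    _ = _ := by
        rw [← mul_assoc, ← ENNReal.ofReal_mul (by positivity), mul_assoc _ |k|, ← abs_mul,
          mul_inv_cancel₀ hk0, abs_one, mul_one]

end BracketIntegrals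

/-! ### Bilinear `L²` estimates with modulation weights -/

section SpaceTimeEstimates

/-- The angular spatial frequency `k = 2πξ` of `ζ = (τ, ξ)`. -/
def spatialFreq (ζ : SpaceTime) : ℝ := 2 * Real.pi * ζ.snd

/-- The modulation `e ω + k²`, `e = ±1`; `e = -1` belongs to complex conjugates. -/
def modulation (e : ℝ) (ζ : SpaceTime) : ℝ := e * (2 * Real.pi * ζ.fst) + spatialFreq ζ ^ 2

theorem continuous_spatialFreq : Continuous spatialFreq := by
  unfold spatialFreq
  fun_prop

theorem continuous_modulation (e : ℝ) : Continuous (modulation e) := by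
  have := continuous_spatialFreq
  unfold modulation
  fun_prop

@[fun_prop]
theorem measurable_spatialFreq : Measurable spatialFreq := continuous_spatialFreq.measurable

@[fun_prop]
theorem measurable_modulation (e : ℝ) : Measurable (modulation e) :=
  (continuous_modulation e).measurable

theorem spatialFreq_add (x y : SpaceTime) :
    spatialFreq (x + y) = spatialFreq x + spatialFreq y := by
  simp only [spatialFreq, WithLp.add_snd]; ring

theorem spatialFreq_neg (x : SpaceTime) : spatialFreq (-x) = -spatialFreq x := by
  simp [spatialFreq]

theorem modulation_neg (e : ℝ) (ζ : SpaceTime) : modulation e (-ζ) = modulation (-e) ζ := by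
  simp only [modulation, spatialFreq_neg, WithLp.neg_fst]; ring

theorem toLp_fst (τ ξ : ℝ) : (WithLp.toLp 2 (τ, ξ) : SpaceTime).fst = τ := rfl

theorem toLp_snd (τ ξ : ℝ) : (WithLp.toLp 2 (τ, ξ) : SpaceTime).snd = ξ := rfl

theorem lintegral_spaceTime {φ : SpaceTime → ℝ≥0∞} (hφ : Measurable φ) :
    ∫⁻ ζ, φ ζ = ∫⁻ ξ : ℝ, ∫⁻ τ : ℝ, φ (WithLp.toLp 2 (τ, ξ)) := by
  have h := (WithLp.volume_preserving_toLp ℝ ℝ).lintegral_comp hφ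
  rw [← h, Measure.volume_eq_prod, lintegral_prod_symm]
  exact (hφ.comp (WithLp.volume_preserving_toLp ℝ ℝ).measurable).aemeasurable

/-- A function with weights `⟨k⟩^{-r} ⟨σ⟩^{-q/2}`, `r > 1/2`, `q > 1`, is integrable. -/
theorem sq_lintegral_weighted_le {r q : ℝ} (hr : 1 / 2 < r) (hq : 1 < q) :
    ∃ C : ℝ≥0, ∀ e : ℝ, e ^ 2 = 1 → ∀ f : SpaceTime → ℝ≥0∞, Measurable f →
      (∫⁻ ζ, bracketPow (-r) (spatialFreq ζ) * (bracketPow (-q / 2) (modulation e ζ) * f ζ)) ^ 2 ≤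
        C * ∫⁻ ζ, f ζ ^ 2 := by
  set I := ∫⁻ x, bracketPow (-q) x with hI
  have hI' : I < ∞ := lintegral_bracketPow_lt_top hq
  set L := ∫⁻ x, bracketPow (-(2 * r)) x with hL
  have hL' : L < ∞ := lintegral_bracketPow_lt_top (by linarith)
  refine ⟨(I * L).toNNReal, fun e he f hf => ?_⟩
  rw [ENNReal.coe_toNNReal (ENNReal.mul_ne_top hI'.ne hL'.ne)]
  simp only [← mul_assoc]
  refine (sq_lintegral_mul_le (by fun_prop) hf.aemeasurable).trans ?_
  gcongr
  rw [lintegral_spaceTime (by fun_prop)]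
  simp only [mul_pow, bracketPow_sq]
  calc _ ≤ ∫⁻ ξ : ℝ, bracketPow (-(2 * r)) (2 * Real.pi * ξ) * I := by
        refine lintegral_mono fun ξ => ?_
        simp only [modulation, spatialFreq, toLp_fst, toLp_snd]
        rw [lintegral_const_mul _ (by fun_prop)]
        refine mul_le_mul' (by rw [mul_neg]) ?_
        refine (lintegral_comp_two_pi_mul_le
          (g := fun x => bracketPow (2 * (-q / 2)) (e * x + (2 * Real.pi * ξ) ^ 2))
          (by fun_prop)).trans (le_of_eq ?_)
        rw [show 2 * (-q / 2) = -q by ring]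
        rcases sq_eq_one_iff.1 he with rfl | rfl
        · simp only [one_mul]
          exact lintegral_add_right_eq_self (fun x => bracketPow (-q) x) _
        · simp only [neg_one_mul, neg_add_eq_sub]
          exact lintegral_sub_left_eq_self (fun x => bracketPow (-q) x) _
    _ ≤ L * I := by
        rw [lintegral_mul_const _ (by fun_prop)]
        gcongr
        exact lintegral_comp_two_pi_mul_le (by fun_prop)
    _ = I * L := mul_comm _ _

/-- Cauchy–Schwarz reduces the claim to a bound, uniform in the output frequency, for the integral
of `⟨σ⟩^{-p}⟨σ'⟩^{-q}`. The time frequency integral leaves a quadratic phase to the power `-p`, so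
`p > 1/2` suffices for one factor and the dual function may carry less than half a power of its
modulation. -/
theorem lintegral_sq_lconvolution_weighted_aux {p q : ℝ} (hp : 1 / 2 < p) (hpq : p ≤ q)
    (hq : 1 < q) :
    ∃ C : ℝ≥0, ∀ f g : SpaceTime → ℝ≥0∞, Measurable f → Measurable g →
      ∫⁻ ζ, ((fun x => bracketPow (-p / 2) (modulation 1 x) * f x) ⋆ₗ
        (fun x => bracketPow (-q / 2) (modulation 1 x) * g x)) ζ ^ 2 ≤
        C * (∫⁻ ζ, f ζ ^ 2) * ∫⁻ ζ, g ζ ^ 2 := by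
  obtain ⟨C₁, hC₁⟩ := lintegral_bracketPow_mul_le (by linarith : 0 < p) hpq hq
  obtain ⟨C₂, hC₂⟩ := lintegral_bracketPow_quadratic_le hp
  refine ⟨C₁ * C₂, fun f g hf hg => ?_⟩
  have hfn : ∫⁻ ζ, f (-ζ) ^ 2 = ∫⁻ ζ, f ζ ^ 2 := lintegral_neg_eq_self (fun ζ => f ζ ^ 2)
  rw [mul_assoc, mul_comm (∫⁻ ζ, f ζ ^ 2), ← mul_assoc, ← hfn]
  refine le_trans (le_of_eq ?_) (lintegral_sq_kernel_le
    (κ := fun ζ y => bracketPow (-p / 2) (modulation 1 (-y)) *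
      bracketPow (-q / 2) (modulation 1 (ζ + y))) (by fun_prop) hg
    (f := fun x => f (-x)) (by fun_prop) fun ζ => ?_)
  · refine lintegral_congr fun ζ => ?_
    rw [lconvolution_eq_neg]
    congr 1
    refine lintegral_congr fun y => ?_
    ring
  · rw [← lintegral_neg_eq_self]
    simp only [neg_neg, ← sub_eq_add_neg, mul_pow, bracketPow_sq]
    rw [lintegral_spaceTime (by fun_prop)]
    -- The sum of the two modulations is free of the inner time frequency; completing the square
    -- gives `k'² + (k - k')² = k²/2 + 2 (k' - k/2)²`.
    calc _ ≤ ∫⁻ ξ : ℝ, C₁ * bracketPow (-p) (2 * Real.pi * ζ.fst + spatialFreq ζ ^ 2 / 2 +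
          2 * (2 * Real.pi * ξ + -(spatialFreq ζ / 2)) ^ 2) := by
          refine lintegral_mono fun ξ => ?_
          have h := (lintegral_comp_two_pi_mul_le (g := fun x => bracketPow (-p)
            ((2 * Real.pi * ξ) ^ 2 + x) * bracketPow (-q) ((2 * Real.pi * ζ.fst +
            (spatialFreq ζ - 2 * Real.pi * ξ) ^ 2) + (-1) * x)) (by fun_prop)).trans
            (hC₁ (-1) (by norm_num) _ _)
          refine le_trans (le_of_eq ?_) (h.trans (le_of_eq ?_))
          · refine lintegral_congr fun τ => ?_
            simp only [modulation, spatialFreq, WithLp.sub_fst, WithLp.sub_snd, toLp_fst, toLp_snd]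
            congr 2 <;> ring
          · congr 2
            ring
      _ ≤ C₁ * C₂ := by
          rw [lintegral_const_mul _ (by fun_prop)]
          gcongr
          exact (lintegral_comp_two_pi_mul_le (g := fun x => bracketPow (-p)
            (2 * Real.pi * ζ.fst + spatialFreq ζ ^ 2 / 2 + 2 * (x + -(spatialFreq ζ / 2)) ^ 2))
            (by fun_prop)).trans (hC₂ _ _)
      _ = ((C₁ * C₂ : ℝ≥0) : ℝ≥0∞) := by push_cast; rfl

/-- The bilinear `L²` estimate `‖f * g‖₂ ≲ ‖⟨σ⟩^{p/2} f‖₂ ‖⟨σ⟩^{q/2} g‖₂`, for all signs. -/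
theorem lintegral_sq_lconvolution_weighted_le {p q : ℝ} (hp : 1 / 2 < p) (hpq : p ≤ q)
    (hq : 1 < q) :
    ∃ C : ℝ≥0, ∀ e₁ e₂ : ℝ, e₁ ^ 2 = 1 → e₂ ^ 2 = 1 → ∀ f g : SpaceTime → ℝ≥0∞,
      Measurable f → Measurable g →
      ∫⁻ ζ, ((fun x => bracketPow (-p / 2) (modulation e₁ x) * f x) ⋆ₗ
        (fun x => bracketPow (-q / 2) (modulation e₂ x) * g x)) ζ ^ 2 ≤
        C * (∫⁻ ζ, f ζ ^ 2) * ∫⁻ ζ, g ζ ^ 2 := by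
  obtain ⟨C, hC⟩ := lintegral_sq_lconvolution_weighted_aux hp hpq hq
  have hneg : ∀ f : SpaceTime → ℝ≥0∞, ∫⁻ ζ, f (-ζ) ^ 2 = ∫⁻ ζ, f ζ ^ 2 :=
    fun f => lintegral_neg_eq_self (fun ζ => f ζ ^ 2)
  have h1 : ∀ e : ℝ, e ^ 2 = 1 → ∀ f g : SpaceTime → ℝ≥0∞, Measurable f → Measurable g →
      ∫⁻ ζ, ((fun x => bracketPow (-p / 2) (modulation e x) * f x) ⋆ₗ
        (fun x => bracketPow (-q / 2) (modulation 1 x) * g x)) ζ ^ 2 ≤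
        C * (∫⁻ ζ, f ζ ^ 2) * ∫⁻ ζ, g ζ ^ 2 := by
    intro e he f g hf hg
    rcases sq_eq_one_iff.1 he with rfl | rfl
    · exact hC f g hf hg
    · rw [← lintegral_sq_lconvolution_neg_left (by fun_prop) (by fun_prop), ← hneg f]
      simp only [modulation_neg, neg_neg]
      exact hC (fun x => f (-x)) g (by fun_prop) hg
  refine ⟨C, fun e₁ e₂ he₁ he₂ f g hf hg => ?_⟩
  rcases sq_eq_one_iff.1 he₂ with rfl | rfl
  · exact h1 e₁ he₁ f g hf hg
  · rw [← lintegral_sq_lconvolution_neg_right (by fun_prop) (by fun_prop), ← hneg g]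
    simp only [modulation_neg, neg_neg]
    exact h1 e₁ he₁ f (fun x => g (-x)) hf (by fun_prop)

/-- The multiplier `1 + ⟨k₀⟩^a` where `⟨k⟩` is much smaller than `⟨k₀⟩`, and `1` elsewhere. -/
def gainWeight (a k₀ k : ℝ) : ℝ≥0∞ :=
  1 + if 20 * japaneseBracket k ≤ japaneseBracket k₀ then bracketPow a k₀ else 0

theorem measurableSet_low_high :
    MeasurableSet {z : ℝ × ℝ | 20 * japaneseBracket z.2 ≤ japaneseBracket z.1} := by
  have := continuous_japaneseBracket
  exact (isClosed_le (by fun_prop) (by fun_prop)).measurableSet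

theorem measurable_ite_low_high (a : ℝ) : Measurable fun z : ℝ × ℝ =>
    if 20 * japaneseBracket z.2 ≤ japaneseBracket z.1 then bracketPow a z.1 else 0 :=
  Measurable.ite measurableSet_low_high (by fun_prop) measurable_const

theorem measurable_gainWeight_prod (a : ℝ) :
    Measurable fun z : ℝ × ℝ => gainWeight a z.1 z.2 :=
  (measurable_ite_low_high a).const_add 1

theorem measurable_gainWeight {α : Type*} [MeasurableSpace α] (a : ℝ) {f g : α → ℝ}
    (hf : Measurable f) (hg : Measurable g) : Measurable (fun z : α => gainWeight a (f z) (g z)) := by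
  have h := (measurable_gainWeight_prod a).comp (hf.prodMk hg)
  exact h

attribute [fun_prop] measurable_gainWeight

/-- Cauchy–Schwarz at fixed difference frequency `y`: after integrating in `τ` the phase is `ω_y +
(k_y + k)² - e k²`, with slope of the order of the output frequency. The exponent `q` of the given
factor serves the integral in `τ`, while the independent `q'`, which can be taken near `1`, serves
the integral in `k`; hence no smallness of `ε` is required. -/
theorem lintegral_sq_low_high_le {p q q' a : ℝ} (hp : 1 / 2 < p) (hpq : p ≤ q) (hq : 1 < q)
    (hpq' : p ≤ q') (hq' : 1 < q') (ha : 0 ≤ a) (hapq : 2 * (q' - p) + 2 * a ≤ 1) :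
    ∃ C : ℝ≥0, ∀ e : ℝ, e ^ 2 = 1 → ∀ w f : SpaceTime → ℝ≥0∞, Measurable w → Measurable f →
      ∫⁻ y, (∫⁻ x, (if 20 * japaneseBracket (spatialFreq x) ≤ japaneseBracket (spatialFreq (y + x))
          then bracketPow a (spatialFreq (y + x)) else 0) *
        (bracketPow (-p / 2) (modulation 1 (y + x)) * w (y + x)) *
        (bracketPow (-q / 2) (modulation e x) * f x)) ^ 2 ≤
        C * (∫⁻ ζ, w ζ ^ 2) * ∫⁻ ζ, f ζ ^ 2 := by
  obtain ⟨C₁, hC₁⟩ := lintegral_bracketPow_mul_le (by linarith : 0 < p) hpq hq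
  obtain ⟨C₂, hC₂⟩ := lintegral_bracketPow_low_high_le (by linarith : 0 < p) hpq' hq' ha hapq
  refine ⟨C₁ * C₂, fun e he w f hw hf => ?_⟩
  have hm : Measurable fun z : SpaceTime × SpaceTime =>
      if 20 * japaneseBracket (spatialFreq z.2) ≤ japaneseBracket (spatialFreq (z.1 + z.2))
        then bracketPow a (spatialFreq (z.1 + z.2)) else 0 :=
    (measurable_ite_low_high a).comp (f := fun z : SpaceTime × SpaceTime =>
      (spatialFreq (z.1 + z.2), spatialFreq z.2)) (by fun_prop)
  refine le_trans (le_of_eq ?_) (lintegral_sq_kernel_le (a := w) (f := f)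
    (κ := fun y x => (if 20 * japaneseBracket (spatialFreq x) ≤ japaneseBracket (spatialFreq (y + x))
          then bracketPow a (spatialFreq (y + x)) else 0) *
      (bracketPow (-p / 2) (modulation 1 (y + x)) * bracketPow (-q / 2) (modulation e x)))
    (hm.mul (by fun_prop)) hw hf fun y => ?_)
  · refine lintegral_congr fun ζ => ?_
    congr 1
    refine lintegral_congr fun y => ?_
    ring
  · set S := {x | 20 * japaneseBracket x ≤ japaneseBracket (spatialFreq y + x)} with hS
    have hSm : MeasurableSet S :=
      measurableSet_low_high.preimage (f := fun x : ℝ => (spatialFreq y + x, x)) (by fun_prop)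
    have hmm : Measurable fun x => ((if 20 * japaneseBracket (spatialFreq x) ≤
        japaneseBracket (spatialFreq (y + x)) then bracketPow a (spatialFreq (y + x)) else 0) *
        (bracketPow (-p / 2) (modulation 1 (y + x)) *
          bracketPow (-q / 2) (modulation e x))) ^ 2 :=
      ((hm.comp (measurable_prodMk_left (x := y))).mul (by fun_prop)).pow_const 2
    rw [lintegral_spaceTime hmm]
    set G : ℝ → ℝ≥0∞ := S.indicator fun x => bracketPow (2 * a) (spatialFreq y + x) *
      bracketPow (-p) (2 * Real.pi * y.fst + (spatialFreq y + x) ^ 2 - e * x ^ 2) with hG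
    have hGm : Measurable G := Measurable.indicator (by fun_prop) hSm
    calc _ ≤ ∫⁻ ξ : ℝ, C₁ * G (2 * Real.pi * ξ) := by
          refine lintegral_mono fun ξ => ?_
          simp only [spatialFreq_add]
          have hsf : ∀ τ : ℝ, spatialFreq (WithLp.toLp 2 (τ, ξ)) = 2 * Real.pi * ξ := fun _ => rfl
          simp only [hsf]
          by_cases hx : 2 * Real.pi * ξ ∈ S
          · have hx' : 20 * japaneseBracket (2 * Real.pi * ξ) ≤
              japaneseBracket (spatialFreq y + 2 * Real.pi * ξ) := hx
            have hsq : ∀ x y z : ℝ≥0∞, (x * (y * z)) ^ 2 = x ^ 2 * (y ^ 2 * z ^ 2) :=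
              fun x y z => by ring
            simp only [if_pos hx', hG, Set.indicator_of_mem hx, hsq, bracketPow_sq]
            rw [lintegral_const_mul _ (by fun_prop), mul_left_comm]
            gcongr
            have h := (lintegral_comp_two_pi_mul_le (g := fun x => bracketPow (-p)
              ((2 * Real.pi * y.fst + (spatialFreq y + 2 * Real.pi * ξ) ^ 2) + x) *
              bracketPow (-q) ((2 * Real.pi * ξ) ^ 2 + e * x)) (by fun_prop)).trans
              (hC₁ e he _ _)
            refine le_trans (le_of_eq ?_) h
            refine lintegral_congr fun τ => ?_
            simp only [modulation, spatialFreq, WithLp.add_fst, WithLp.add_snd, toLp_fst, toLp_snd]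
            congr 2 <;> ring
          · have hx' : ¬ 20 * japaneseBracket (2 * Real.pi * ξ) ≤
              japaneseBracket (spatialFreq y + 2 * Real.pi * ξ) := hx
            simp [if_neg hx']
      _ ≤ C₁ * C₂ := by
          rw [lintegral_const_mul _ (by fun_prop)]
          gcongr
          refine (lintegral_comp_two_pi_mul_le hGm).trans ?_
          rw [hG, lintegral_indicator hSm]
          exact hC₂ e he _ _
      _ = ((C₁ * C₂ : ℝ≥0) : ℝ≥0∞) := by push_cast; rfl

theorem add_sq_le_two_mul (x y : ℝ≥0∞) : (x + y) ^ 2 ≤ 2 * (x ^ 2 + y ^ 2) := by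
  have h := ENNReal.rpow_add_le_mul_rpow_add_rpow x y (p := 2) (by norm_num)
  norm_num at h
  exact h

/-- The bilinear estimate with gain: `gainWeight` is absorbed by the modulation weights. -/
theorem lintegral_sq_gainWeight_le {p q q' a : ℝ} (hp : 1 / 2 < p) (hpq : p ≤ q) (hq : 1 < q)
    (hpq' : p ≤ q') (hq' : 1 < q') (ha : 0 ≤ a) (hapq : 2 * (q' - p) + 2 * a ≤ 1) :
    ∃ C : ℝ≥0, ∀ e : ℝ, e ^ 2 = 1 → ∀ w f : SpaceTime → ℝ≥0∞, Measurable w → Measurable f →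
      ∫⁻ y, (∫⁻ x, gainWeight a (spatialFreq (y + x)) (spatialFreq x) *
        (bracketPow (-p / 2) (modulation 1 (y + x)) * w (y + x)) *
        (bracketPow (-q / 2) (modulation e x) * f x)) ^ 2 ≤
        C * (∫⁻ ζ, w ζ ^ 2) * ∫⁻ ζ, f ζ ^ 2 := by
  obtain ⟨C₁, hC₁⟩ := lintegral_sq_lconvolution_weighted_le hp hpq hq
  obtain ⟨C₂, hC₂⟩ := lintegral_sq_low_high_le hp hpq hq hpq' hq' ha hapq
  refine ⟨2 * (C₁ + C₂), fun e he w f hw hf => ?_⟩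
  set W : SpaceTime → ℝ≥0∞ := fun x => bracketPow (-p / 2) (modulation 1 x) * w x with hW
  set F : SpaceTime → ℝ≥0∞ := fun x => bracketPow (-q / 2) (modulation e x) * f x with hF
  have hWm : Measurable W := by fun_prop
  have hFm : Measurable F := by fun_prop
  have hm : Measurable fun z : SpaceTime × SpaceTime =>
      if 20 * japaneseBracket (spatialFreq z.2) ≤ japaneseBracket (spatialFreq (z.1 + z.2))
        then bracketPow a (spatialFreq (z.1 + z.2)) else 0 :=
    (measurable_ite_low_high a).comp (f := fun z : SpaceTime × SpaceTime =>
      (spatialFreq (z.1 + z.2), spatialFreq z.2)) (by fun_prop)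
  -- The constant part of `gainWeight` gives a correlation rather than a convolution; reflecting `F`
  -- identifies their `L²` norms.
  have h1 : ∫⁻ y, (∫⁻ x, W (y + x) * F x) ^ 2 ≤ C₁ * (∫⁻ ζ, w ζ ^ 2) * ∫⁻ ζ, f ζ ^ 2 := by
    refine le_trans (le_of_eq ?_) (hC₁ 1 e (by norm_num) he w f hw hf)
    rw [← lintegral_sq_lconvolution_neg_right hWm hFm, lconvolution_comm]
    refine lintegral_congr fun y => ?_
    rw [lconvolution_eq_neg]
    simp only [neg_neg, mul_comm]
  have h2 := hC₂ e he w f hw hf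
  calc _ = ∫⁻ y, (∫⁻ x, W (y + x) * F x + (if 20 * japaneseBracket (spatialFreq x) ≤
          japaneseBracket (spatialFreq (y + x)) then bracketPow a (spatialFreq (y + x)) else 0) *
          W (y + x) * F x) ^ 2 := by
        refine lintegral_congr fun y => ?_
        congr 1
        refine lintegral_congr fun x => ?_
        rw [gainWeight, add_mul, add_mul, one_mul]
    _ ≤ ∫⁻ y, 2 * ((∫⁻ x, W (y + x) * F x) ^ 2 + (∫⁻ x, (if 20 * japaneseBracket (spatialFreq x) ≤
          japaneseBracket (spatialFreq (y + x)) then bracketPow a (spatialFreq (y + x)) else 0) *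
          W (y + x) * F x) ^ 2) := by
        refine lintegral_mono fun y => ?_
        rw [lintegral_add_left (by fun_prop)]
        exact add_sq_le_two_mul _ _
    _ = 2 * ((∫⁻ y, (∫⁻ x, W (y + x) * F x) ^ 2) + ∫⁻ y, (∫⁻ x, (if 20 * japaneseBracket (spatialFreq x) ≤
          japaneseBracket (spatialFreq (y + x)) then bracketPow a (spatialFreq (y + x)) else 0) *
          W (y + x) * F x) ^ 2) := by
        rw [lintegral_const_mul' _ _ (by simp), lintegral_add_left (by fun_prop)]
    _ ≤ 2 * (C₁ * (∫⁻ ζ, w ζ ^ 2) * (∫⁻ ζ, f ζ ^ 2) +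
          C₂ * (∫⁻ ζ, w ζ ^ 2) * ∫⁻ ζ, f ζ ^ 2) := by
        gcongr
    _ = _ := by push_cast; ring

end SpaceTimeEstimates

/-! ### Redistribution of the spatial weights among ordered frequencies -/

section WeightInequality

/-- The largest bracket `B₄` pays for `R^s` when `B₀` is small, and `B₀`, `B₁` pay for all of
`R^{s+a}` otherwise. In both cases the total negative power left over is at least `3s` and sits at
brackets no smaller than `B₁`, so it can be lowered to `3s/2` at each of `B₁` and `B₂`. -/
theorem rpow_weight_le {s a R B₀ B₁ B₂ B₃ B₄ : ℝ} (hs : 0 ≤ s) (ha : 0 ≤ a) (has : a ≤ s)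
    (hR : 1 ≤ R) (h0 : 1 ≤ B₀) (h01 : B₀ ≤ B₁) (h12 : B₁ ≤ B₂) (h23 : B₂ ≤ B₃) (h34 : B₃ ≤ B₄)
    (hsum : R ≤ B₀ + B₁ + B₂ + B₃ + B₄) :
    R ^ (s + a) * (B₀ ^ (-s) * B₁ ^ (-s) * B₂ ^ (-s) * B₃ ^ (-s) * B₄ ^ (-s)) ≤
      20 ^ (s + a) * (1 + if 20 * B₀ ≤ R then R ^ a else 0) *
        (B₁ ^ (-(3 * s / 2)) * B₂ ^ (-(3 * s / 2))) := by
  have hR0 : 0 < R := by linarith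
  have p0 : 0 < B₀ := by linarith
  have p1 : 0 < B₁ := by linarith
  have p2 : 0 < B₂ := by linarith
  have p3 : 0 < B₃ := by linarith
  have p4 : 0 < B₄ := by linarith
  have anti : ∀ {X Y t : ℝ}, 0 < X → X ≤ Y → 0 ≤ t → Y ^ (-t) ≤ X ^ (-t) := fun hX hXY ht =>
    Real.rpow_le_rpow_of_nonpos hX hXY (by linarith)
  have inv : ∀ {X : ℝ}, 0 < X → X ^ s * X ^ (-s) = 1 := fun hX => by
    rw [← Real.rpow_add hX, add_neg_cancel, Real.rpow_zero]
  have hs2 : 0 ≤ s / 2 := by linarith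
  split_ifs with hc
  -- Low `B₀`: the factor `R^a` is kept for the gain weight, `B₀^{-s}` is discarded, and `B₃^{-s}`
  -- is split evenly between `B₁` and `B₂`.
  · have e1 : R ^ s ≤ 20 ^ s * B₄ ^ s := by
      rw [← Real.mul_rpow (by norm_num) p4.le]
      exact Real.rpow_le_rpow hR0.le (by linarith) hs
    have e2 : B₀ ^ (-s) ≤ 1 := Real.rpow_le_one_of_one_le_of_nonpos h0 (by linarith)
    have e3 : B₃ ^ (-s) ≤ B₁ ^ (-(s / 2)) * B₂ ^ (-(s / 2)) := by
      calc B₃ ^ (-s) = B₃ ^ (-(s / 2)) * B₃ ^ (-(s / 2)) := by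
            rw [← Real.rpow_add p3]; ring_nf
        _ ≤ _ := mul_le_mul (anti p1 (h12.trans h23) hs2) (anti p2 h23 hs2)
            (by positivity) (by positivity)
    have e4 : ∀ {X : ℝ}, 0 < X → X ^ (-s) * X ^ (-(s / 2)) = X ^ (-(3 * s / 2)) := fun hX => by
      rw [← Real.rpow_add hX]; ring_nf
    calc R ^ (s + a) * (B₀ ^ (-s) * B₁ ^ (-s) * B₂ ^ (-s) * B₃ ^ (-s) * B₄ ^ (-s))
        = R ^ a * R ^ s * (B₀ ^ (-s) * B₁ ^ (-s) * B₂ ^ (-s) * B₃ ^ (-s) * B₄ ^ (-s)) := by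
          rw [Real.rpow_add hR0]; ring
      _ ≤ R ^ a * (20 ^ s * B₄ ^ s) * (1 * B₁ ^ (-s) * B₂ ^ (-s) *
          (B₁ ^ (-(s / 2)) * B₂ ^ (-(s / 2))) * B₄ ^ (-s)) := by gcongr
      _ = 20 ^ s * R ^ a * (B₄ ^ s * B₄ ^ (-s)) * ((B₁ ^ (-s) * B₁ ^ (-(s / 2))) *
          (B₂ ^ (-s) * B₂ ^ (-(s / 2)))) := by ring
      _ = 20 ^ s * R ^ a * (B₁ ^ (-(3 * s / 2)) * B₂ ^ (-(3 * s / 2))) := by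
          rw [inv p4, e4 p1, e4 p2, mul_one]
      _ ≤ _ := by
          gcongr
          · norm_num
          · linarith
          · linarith
  -- Here every bracket is at least `R / 20`. The inequality `a ≤ s` lets `B₁^s` absorb `B₀^a`, and
  -- the decay at `B₂`, `B₃`, `B₄` is shared between `B₁` and `B₂`.
  · have e1 : R ^ (s + a) ≤ 20 ^ (s + a) * (B₀ ^ s * B₁ ^ s) := by
      have h1 : R ^ (s + a) ≤ 20 ^ (s + a) * B₀ ^ (s + a) := by
        rw [← Real.mul_rpow (by norm_num) p0.le]
        exact Real.rpow_le_rpow hR0.le (not_le.1 hc).le (by linarith)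
      have h2 : B₀ ^ a ≤ B₁ ^ s := (Real.rpow_le_rpow p0.le h01 ha).trans
        (Real.rpow_le_rpow_of_exponent_le (h0.trans h01) has)
      rw [Real.rpow_add p0] at h1
      exact h1.trans (by gcongr)
    have e2 : ∀ {X : ℝ}, 0 < X → B₂ ≤ X → X ^ (-s) ≤ B₁ ^ (-(s / 2)) * B₂ ^ (-(s / 2)) := by
      intro X hX h
      calc X ^ (-s) = X ^ (-(s / 2)) * X ^ (-(s / 2)) := by rw [← Real.rpow_add hX]; ring_nf
        _ ≤ _ := mul_le_mul (anti p1 (h12.trans h) hs2) (anti p2 h hs2)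
            (by positivity) (by positivity)
    have e4 : ∀ {X : ℝ}, 0 < X → X ^ (-(s / 2)) * X ^ (-(s / 2)) * X ^ (-(s / 2)) =
        X ^ (-(3 * s / 2)) := fun hX => by
      rw [← Real.rpow_add hX, ← Real.rpow_add hX]; ring_nf
    calc R ^ (s + a) * (B₀ ^ (-s) * B₁ ^ (-s) * B₂ ^ (-s) * B₃ ^ (-s) * B₄ ^ (-s))
        ≤ 20 ^ (s + a) * (B₀ ^ s * B₁ ^ s) * (B₀ ^ (-s) * B₁ ^ (-s) *
          (B₁ ^ (-(s / 2)) * B₂ ^ (-(s / 2))) * (B₁ ^ (-(s / 2)) * B₂ ^ (-(s / 2))) *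
          (B₁ ^ (-(s / 2)) * B₂ ^ (-(s / 2)))) := by
          gcongr
          · exact e2 p2 le_rfl
          · exact e2 p3 h23
          · exact e2 p4 (h23.trans h34)
      _ = 20 ^ (s + a) * ((B₀ ^ s * B₀ ^ (-s)) * (B₁ ^ s * B₁ ^ (-s))) *
          ((B₁ ^ (-(s / 2)) * B₁ ^ (-(s / 2)) * B₁ ^ (-(s / 2))) *
            (B₂ ^ (-(s / 2)) * B₂ ^ (-(s / 2)) * B₂ ^ (-(s / 2)))) := by ring
      _ = _ := by rw [inv p0, inv p1, e4 p1, e4 p2]; ring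

theorem bracketPow_weight_le {s a : ℝ} (hs : 0 ≤ s) (ha : 0 ≤ a) (has : a ≤ s) (k : Fin 5 → ℝ) :
    ∃ ρ : Equiv.Perm (Fin 5), bracketPow (s + a) (∑ i, k i) * ∏ i, bracketPow (-s) (k i) ≤
      ENNReal.ofReal (20 ^ (s + a)) * (gainWeight a (∑ i, k i) (k (ρ 4)) *
        (bracketPow (-(3 * s / 2)) (k (ρ 0)) * bracketPow (-(3 * s / 2)) (k (ρ 1)))) := by
  set B : Fin 5 → ℝ := fun i => japaneseBracket (k i) with hB
  set σ := Tuple.sort B with hσ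
  have hmono : Monotone (B ∘ σ) := Tuple.monotone_sort B
  -- The rotation puts the smallest bracket at index `4`, the next two at `0` and `1`, and the two
  -- largest at `2` and `3`, the roles expected by `lintegral_five_ordered_le`.
  refine ⟨(finRotate 5).trans σ, ?_⟩
  have hsum : japaneseBracket (∑ i, k i) ≤ B (σ 0) + B (σ 1) + B (σ 2) + B (σ 3) + B (σ 4) := by
    rw [← Equiv.sum_comp σ k, Fin.sum_univ_five]
    refine (japaneseBracket_add_le _ _).trans (add_le_add_left ?_ _)
    refine (japaneseBracket_add_le _ _).trans (add_le_add_left ?_ _)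
    refine (japaneseBracket_add_le _ _).trans (add_le_add_left ?_ _)
    exact japaneseBracket_add_le _ _
  have h := rpow_weight_le hs ha has (one_le_japaneseBracket (∑ i, k i))
    (one_le_japaneseBracket (k (σ 0))) (hmono (show (0 : Fin 5) ≤ 1 by decide))
    (hmono (show (1 : Fin 5) ≤ 2 by decide)) (hmono (show (2 : Fin 5) ≤ 3 by decide))
    (hmono (show (3 : Fin 5) ≤ 4 by decide)) hsum
  have hn : ∀ r y : ℝ, 0 ≤ japaneseBracket y ^ r := fun r y =>
    Real.rpow_nonneg (japaneseBracket_pos y).le r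
  have hr4 : (finRotate 5).trans σ 4 = σ 0 := by
    simp only [Equiv.trans_apply]; congr 1
  have hr0 : (finRotate 5).trans σ 0 = σ 1 := by
    simp only [Equiv.trans_apply]; congr 1
  have hr1 : (finRotate 5).trans σ 1 = σ 2 := by
    simp only [Equiv.trans_apply]; congr 1
  have hg : gainWeight a (∑ i, k i) (k (σ 0)) = ENNReal.ofReal
      (1 + if 20 * japaneseBracket (k (σ 0)) ≤ japaneseBracket (∑ i, k i)
        then japaneseBracket (∑ i, k i) ^ a else 0) := by
    rw [gainWeight]
    split_ifs
    · rw [ENNReal.ofReal_add zero_le_one (hn _ _), ENNReal.ofReal_one, bracketPow]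
    · simp
  have hif : 0 ≤ 1 + if 20 * japaneseBracket (k (σ 0)) ≤ japaneseBracket (∑ i, k i)
        then japaneseBracket (∑ i, k i) ^ a else 0 := by
    split_ifs
    · linarith [hn a (∑ i, k i)]
    · norm_num
  rw [hr4, hr0, hr1, hg, ← Equiv.prod_comp σ, Fin.prod_univ_five]
  simp only [bracketPow]
  have q0 := japaneseBracket_pos (k (σ 0))
  have q1 := japaneseBracket_pos (k (σ 1))
  have q2 := japaneseBracket_pos (k (σ 2))
  have q3 := japaneseBracket_pos (k (σ 3))
  have qR := japaneseBracket_pos (∑ i, k i)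
  rw [← ENNReal.ofReal_mul (by positivity), ← ENNReal.ofReal_mul (by positivity),
    ← ENNReal.ofReal_mul (by positivity), ← ENNReal.ofReal_mul (by positivity),
    ← ENNReal.ofReal_mul (by positivity), ← ENNReal.ofReal_mul (by positivity),
    ← ENNReal.ofReal_mul hif, ← ENNReal.ofReal_mul (by positivity), ← mul_assoc (20 ^ (s + a))]
  exact ENNReal.ofReal_le_ofReal h

end WeightInequality

/-! ### Iterated integrals over five variables and permutation invariance -/

section PiIntegrals

variable {E : Type*} [MeasureSpace E] [SigmaFinite (volume : Measure E)]

theorem lintegral_pi_fin_succ {n : ℕ} {H : (Fin (n + 1) → E) → ℝ≥0∞} (hH : Measurable H) :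
    ∫⁻ x, H x = ∫⁻ y : E, ∫⁻ z : Fin n → E, H (Fin.cons y z) := by
  have h := (volume_preserving_piFinSuccAbove (fun _ : Fin (n + 1) => E) 0).symm
  rw [← h.lintegral_comp hH, Measure.volume_eq_prod, lintegral_prod]
  · refine lintegral_congr fun y => lintegral_congr fun z => ?_
    rw [← Fin.insertNth_zero']
    rfl
  · exact (hH.comp h.measurable).aemeasurable

omit [SigmaFinite (volume : Measure E)] in
theorem measurable_cons_right {n : ℕ} (y : E) :
    Measurable fun z : Fin n → E => (Fin.cons y z : Fin (n + 1) → E) := by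
  refine measurable_pi_iff.2 fun i => ?_
  refine Fin.cases ?_ (fun j => ?_) i
  · simp
  · simpa using measurable_pi_apply j

theorem lintegral_pi_fin_five {H : (Fin 5 → E) → ℝ≥0∞} (hH : Measurable H) :
    ∫⁻ x, H x = ∫⁻ x₀ : E, ∫⁻ x₁ : E, ∫⁻ x₂ : E, ∫⁻ x₃ : E, ∫⁻ x₄ : E, H ![x₀, x₁, x₂, x₃, x₄] := by
  have hc : ∀ {n : ℕ} {G : (Fin (n + 1) → E) → ℝ≥0∞}, Measurable G → ∀ y : E,
      Measurable fun z : Fin n → E => G (Fin.cons y z) :=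
    fun hG y => hG.comp (measurable_cons_right y)
  rw [lintegral_pi_fin_succ hH]
  refine lintegral_congr fun x₀ => ?_
  have h0 := hc hH x₀
  rw [lintegral_pi_fin_succ h0]
  refine lintegral_congr fun x₁ => ?_
  have h1 := hc h0 x₁
  rw [lintegral_pi_fin_succ h1]
  refine lintegral_congr fun x₂ => ?_
  have h2 := hc h1 x₂
  rw [lintegral_pi_fin_succ h2]
  refine lintegral_congr fun x₃ => ?_
  have h3 := hc h2 x₃
  rw [lintegral_pi_fin_succ h3]
  refine lintegral_congr fun x₄ => ?_
  rw [volume_pi, Measure.pi_of_empty, lintegral_dirac]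
  congr 1

theorem lintegral_pi_perm {n : ℕ} (ρ : Equiv.Perm (Fin n)) (F : (Fin n → E) → ℝ≥0∞) :
    ∫⁻ x, F (x ∘ ρ.symm) = ∫⁻ x, F x := by
  have h := (volume_measurePreserving_piCongrLeft (fun _ : Fin n => E) ρ).lintegral_comp_emb
    (MeasurableEquiv.measurableEmbedding _) F
  rw [← h]
  refine lintegral_congr fun x => ?_
  congr 1
  funext i
  obtain ⟨j, rfl⟩ := ρ.surjective i
  rw [MeasurableEquiv.coe_piCongrLeft, Equiv.piCongrLeft_apply_apply, Function.comp_apply,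
    Equiv.symm_apply_apply]

end PiIntegrals

/-! ### The quintilinear form -/

section Quintilinear

theorem le_rpow_half_of_sq_le {x y : ℝ≥0∞} (h : x ^ 2 ≤ y) : x ≤ y ^ (1 / 2 : ℝ) := by
  have := ENNReal.rpow_le_rpow h (z := 1 / 2) (by norm_num)
  rwa [← ENNReal.rpow_natCast, ← ENNReal.rpow_mul,
    show ((2 : ℕ) : ℝ) * (1 / 2) = 1 by norm_num, ENNReal.rpow_one] at this

theorem rpow_half_sq (y : ℝ≥0∞) : (y ^ (1 / 2 : ℝ)) ^ 2 = y := by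
  rw [← ENNReal.rpow_natCast, ← ENNReal.rpow_mul,
    show (1 / 2 : ℝ) * ((2 : ℕ) : ℝ) = 1 by norm_num, ENNReal.rpow_one]

/-- The quintilinear estimate in which two of the functions are estimated in `L¹`, two in a
bilinear `L²` estimate, and the last one together with the dual function. -/
theorem lintegral_five_ordered_le {p q q' a r : ℝ} (hp : 1 / 2 < p) (hpq : p ≤ q) (hq : 1 < q)
    (hpq' : p ≤ q') (hq' : 1 < q') (ha : 0 ≤ a) (hapq : 2 * (q' - p) + 2 * a ≤ 1)
    (hr : 1 / 2 < r) :
    ∃ C : ℝ≥0, ∀ e : Fin 5 → ℝ, (∀ i, e i ^ 2 = 1) → ∀ (w : SpaceTime → ℝ≥0∞)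
      (φ : Fin 5 → SpaceTime → ℝ≥0∞), Measurable w → (∀ i, Measurable (φ i)) →
      (∫⁻ x : Fin 5 → SpaceTime, gainWeight a (∑ i, spatialFreq (x i)) (spatialFreq (x 4)) *
        (bracketPow (-r) (spatialFreq (x 0)) * bracketPow (-r) (spatialFreq (x 1))) *
        ((bracketPow (-p / 2) (modulation 1 (∑ i, x i)) * w (∑ i, x i)) *
          ∏ i, (bracketPow (-q / 2) (modulation (e i) (x i)) * φ i (x i)))) ^ 2 ≤
        C * ((∫⁻ ζ, w ζ ^ 2) * ∏ i, ∫⁻ ζ, φ i ζ ^ 2) := by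
  obtain ⟨C₁, hC₁⟩ := sq_lintegral_weighted_le hr hq
  obtain ⟨C₂, hC₂⟩ := lintegral_sq_lconvolution_weighted_le (by linarith : 1 / 2 < q) le_rfl hq
  obtain ⟨C₃, hC₃⟩ := lintegral_sq_gainWeight_le hp hpq hq hpq' hq' ha hapq
  refine ⟨C₁ * C₁ * C₂ * C₃, fun e he w φ hw hφ => ?_⟩
  set W : SpaceTime → ℝ≥0∞ := fun ζ => bracketPow (-p / 2) (modulation 1 ζ) * w ζ with hW
  set F : Fin 5 → SpaceTime → ℝ≥0∞ :=
    fun i ζ => bracketPow (-q / 2) (modulation (e i) ζ) * φ i ζ with hF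
  have hWm : Measurable W := by fun_prop
  have hFm : ∀ i, Measurable (F i) := fun i => by have := hφ i; fun_prop
  set g : Fin 5 → SpaceTime → ℝ≥0∞ := fun i ζ => bracketPow (-r) (spatialFreq ζ) * F i ζ with hg
  have hgm : ∀ i, Measurable (g i) := fun i => by have := hFm i; fun_prop
  -- `B` combines the dual function with the factor of lowest spatial frequency; it is square
  -- integrable by the bilinear estimate with gain.
  set B : SpaceTime → ℝ≥0∞ := fun y => ∫⁻ x,
    gainWeight a (spatialFreq (y + x)) (spatialFreq x) * W (y + x) * F 4 x with hB
  have hF4 := hFm 4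
  have hBm : Measurable B := by
    rw [hB]
    refine Measurable.lintegral_prod_right' (f := fun z : SpaceTime × SpaceTime =>
      gainWeight a (spatialFreq (z.1 + z.2)) (spatialFreq z.2) * W (z.1 + z.2) * F 4 z.2) ?_
    fun_prop
  set N : Fin 5 → ℝ≥0∞ := fun i => ∫⁻ ζ, φ i ζ ^ 2 with hN
  set X := C₂ * (N 2) * (N 3) * (C₃ * (∫⁻ ζ, w ζ ^ 2) * N 4) with hX
  -- With `c = x₀ + x₁` frozen, this is the `L²` pairing of `F 2 ⋆ₗ F 3` with a translate of `B`.
  -- Translation invariance makes the bound uniform in `c`, so the first two variables only need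
  -- `L¹` bounds.
  have hinner : ∀ c : SpaceTime, ∫⁻ x₂, F 2 x₂ * ∫⁻ x₃, F 3 x₃ * B (c + (x₂ + x₃)) ≤
      X ^ (1 / 2 : ℝ) := by
    intro c
    refine le_rpow_half_of_sq_le ?_
    rw [← lintegral_mul_lconvolution (w := fun ζ => B (c + ζ)) (by fun_prop) (hFm 2) (hFm 3)]
    refine (sq_lintegral_mul_le (by fun_prop)
      (measurable_lconvolution _ (hFm 2) (hFm 3)).aemeasurable).trans ?_
    rw [mul_comm, lintegral_add_left_eq_self (fun ζ => B ζ ^ 2) c, hX]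
    exact mul_le_mul' (hC₂ _ _ (he 2) (he 3) _ _ (hφ 2) (hφ 3)) (hC₃ _ (he 4) _ _ hw (hφ 4))
  have hmeas : Measurable fun x : Fin 5 → SpaceTime =>
      gainWeight a (∑ i, spatialFreq (x i)) (spatialFreq (x 4)) *
        (bracketPow (-r) (spatialFreq (x 0)) * bracketPow (-r) (spatialFreq (x 1))) *
        (W (∑ i, x i) * ∏ i, F i (x i)) := by
    fun_prop
  have hT : ∫⁻ x : Fin 5 → SpaceTime, gainWeight a (∑ i, spatialFreq (x i)) (spatialFreq (x 4)) *
        (bracketPow (-r) (spatialFreq (x 0)) * bracketPow (-r) (spatialFreq (x 1))) *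
        (W (∑ i, x i) * ∏ i, F i (x i)) ≤
      (∫⁻ x, g 0 x) * (∫⁻ x, g 1 x) * X ^ (1 / 2 : ℝ) := by
    rw [lintegral_pi_fin_five hmeas]
    have hg0 := hgm 0
    have hg1 := hgm 1
    have hF2 := hFm 2
    have hF3 := hFm 3
    calc _ = ∫⁻ x₀, g 0 x₀ * ∫⁻ x₁, g 1 x₁ * ∫⁻ x₂, F 2 x₂ * ∫⁻ x₃, F 3 x₃ *
          B (x₀ + x₁ + (x₂ + x₃)) := by
          refine lintegral_congr fun x₀ => ?_
          rw [← lintegral_const_mul _ (by fun_prop)]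
          refine lintegral_congr fun x₁ => ?_
          rw [← mul_assoc, ← lintegral_const_mul _ (by fun_prop)]
          refine lintegral_congr fun x₂ => ?_
          rw [← mul_assoc, ← lintegral_const_mul _ (by fun_prop)]
          refine lintegral_congr fun x₃ => ?_
          rw [← mul_assoc, hB]
          simp only
          rw [← lintegral_const_mul _ (by fun_prop)]
          refine lintegral_congr fun x₄ => ?_
          have e1 : x₀ + x₁ + (x₂ + x₃) + x₄ = x₀ + x₁ + x₂ + x₃ + x₄ := by abel
          simp only [Fin.sum_univ_five, Fin.prod_univ_five, hg, e1, ← spatialFreq_add]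
          simp only [Matrix.cons_val]
          ring
      _ ≤ ∫⁻ x₀, g 0 x₀ * ∫⁻ x₁, g 1 x₁ * X ^ (1 / 2 : ℝ) := by
          gcongr with x₀ x₁
          exact hinner _
      _ = _ := by
          rw [lintegral_mul_const _ hg1, lintegral_mul_const _ hg0, mul_assoc]
  calc _ ≤ ((∫⁻ x, g 0 x) * (∫⁻ x, g 1 x) * X ^ (1 / 2 : ℝ)) ^ 2 := by gcongr
    _ = (∫⁻ x, g 0 x) ^ 2 * (∫⁻ x, g 1 x) ^ 2 * X := by rw [mul_pow, mul_pow, rpow_half_sq]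
    _ ≤ (C₁ * N 0) * (C₁ * N 1) * X := by
        gcongr
        · exact hC₁ _ (he 0) _ (hφ 0)
        · exact hC₁ _ (he 1) _ (hφ 1)
    _ = _ := by
        rw [Fin.prod_univ_five, hX]
        push_cast
        ring

/-- The quintilinear estimate in dual form. -/
theorem lintegral_five_le {s p q q' a : ℝ} (hs : 1 / 3 < s) (hp : 1 / 2 < p) (hpq : p ≤ q)
    (hq : 1 < q) (hpq' : p ≤ q') (hq' : 1 < q') (ha : 0 ≤ a) (has : a ≤ s)
    (hapq : 2 * (q' - p) + 2 * a ≤ 1) :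
    ∃ C : ℝ≥0, ∀ e : Fin 5 → ℝ, (∀ i, e i ^ 2 = 1) → ∀ (w : SpaceTime → ℝ≥0∞)
      (φ : Fin 5 → SpaceTime → ℝ≥0∞), Measurable w → (∀ i, Measurable (φ i)) →
      (∫⁻ x : Fin 5 → SpaceTime, (bracketPow (s + a) (spatialFreq (∑ i, x i)) *
          (bracketPow (-p / 2) (modulation 1 (∑ i, x i)) * w (∑ i, x i))) *
          ∏ i, (bracketPow (-s) (spatialFreq (x i)) *
            (bracketPow (-q / 2) (modulation (e i) (x i)) * φ i (x i)))) ^ 2 ≤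
        C * ((∫⁻ ζ, w ζ ^ 2) * ∏ i, ∫⁻ ζ, φ i ζ ^ 2) := by
  obtain ⟨C, hC⟩ := lintegral_five_ordered_le hp hpq hq hpq' hq' ha hapq
    (show 1 / 2 < 3 * s / 2 by linarith)
  set K := ENNReal.ofReal (20 ^ (s + a)) with hK
  refine ⟨(K * Fintype.card (Equiv.Perm (Fin 5))).toNNReal ^ 2 * C, fun e he w φ hw hφ => ?_⟩
  set W : SpaceTime → ℝ≥0∞ := fun ζ => bracketPow (-p / 2) (modulation 1 ζ) * w ζ with hW
  set F : Fin 5 → SpaceTime → ℝ≥0∞ :=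
    fun i ζ => bracketPow (-q / 2) (modulation (e i) ζ) * φ i ζ with hF
  have hWm : Measurable W := by fun_prop
  have hFm : ∀ i, Measurable (F i) := fun i => by have := hφ i; fun_prop
  set X := C * ((∫⁻ ζ, w ζ ^ 2) * ∏ i, ∫⁻ ζ, φ i ζ ^ 2) with hX
  set T : Equiv.Perm (Fin 5) → (Fin 5 → SpaceTime) → ℝ≥0∞ := fun ρ x =>
    gainWeight a (∑ i, spatialFreq (x i)) (spatialFreq (x (ρ 4))) *
      (bracketPow (-(3 * s / 2)) (spatialFreq (x (ρ 0))) *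
        bracketPow (-(3 * s / 2)) (spatialFreq (x (ρ 1)))) *
      (W (∑ i, x i) * ∏ i, F i (x i)) with hT
  have hTm : ∀ ρ, Measurable (T ρ) := by
    intro ρ
    fun_prop
  have hTle : ∀ ρ, ∫⁻ x, T ρ x ≤ X ^ (1 / 2 : ℝ) := by
    intro ρ
    refine le_rpow_half_of_sq_le ?_
    -- The ordered estimate is applied to permuted factors, and its bound is symmetric in them.
    have h := hC (e ∘ ρ) (fun i => he _) w (fun i => φ (ρ i)) hw (fun i => hφ _)
    rw [Equiv.prod_comp ρ (fun i => ∫⁻ ζ, φ i ζ ^ 2)] at h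
    refine le_trans (le_of_eq ?_) h
    rw [← lintegral_pi_perm ρ]
    congr 1
    refine lintegral_congr fun x => ?_
    simp only [hT, Function.comp_apply, Equiv.symm_apply_apply]
    rw [Equiv.sum_comp ρ.symm (fun i => spatialFreq (x i)), Equiv.sum_comp ρ.symm x,
      ← Equiv.prod_comp ρ]
    simp only [Equiv.symm_apply_apply, hF, hW]
  have hpt : ∀ x : Fin 5 → SpaceTime, (bracketPow (s + a) (spatialFreq (∑ i, x i)) *
      W (∑ i, x i)) * ∏ i, (bracketPow (-s) (spatialFreq (x i)) * F i (x i)) ≤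
        K * ∑ ρ, T ρ x := by
    intro x
    obtain ⟨ρ, hρ⟩ := bracketPow_weight_le (by linarith) ha has fun i => spatialFreq (x i)
    have hsum : spatialFreq (∑ i, x i) = ∑ i, spatialFreq (x i) := by
      simp only [Fin.sum_univ_five, spatialFreq_add]
    rw [Finset.prod_mul_distrib, hsum]
    calc _ = bracketPow (s + a) (∑ i, spatialFreq (x i)) *
          (∏ i, bracketPow (-s) (spatialFreq (x i))) * (W (∑ i, x i) * ∏ i, F i (x i)) := by ring
      _ ≤ _ := mul_le_mul' hρ le_rfl
      _ = K * T ρ x := by rw [hT]; ring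
      -- The ordering varies with `x`; summing over all permutations removes the choice.
      _ ≤ K * ∑ ρ, T ρ x := by
          gcongr
          exact Finset.single_le_sum (f := fun ρ => T ρ x) (fun _ _ => zero_le) (Finset.mem_univ ρ)
  have hK' : K * Fintype.card (Equiv.Perm (Fin 5)) ≠ ∞ :=
    ENNReal.mul_ne_top ENNReal.ofReal_ne_top (by simp)
  calc _ ≤ (∫⁻ x, K * ∑ ρ, T ρ x) ^ 2 := by
        exact pow_le_pow_left₀ zero_le (lintegral_mono hpt) 2
    _ = (K * ∑ ρ, ∫⁻ x, T ρ x) ^ 2 := by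
        rw [lintegral_const_mul _ (by fun_prop), lintegral_finsetSum _ (fun ρ _ => hTm ρ)]
    _ ≤ (K * ∑ _ρ : Equiv.Perm (Fin 5), X ^ (1 / 2 : ℝ)) ^ 2 := by
        gcongr with ρ
        exact hTle ρ
    _ = (K * Fintype.card (Equiv.Perm (Fin 5))) ^ 2 * X := by
        rw [Finset.sum_const, nsmul_eq_mul, ← mul_assoc, mul_pow, rpow_half_sq, Finset.card_univ]
    _ = _ := by
        rw [hX, ENNReal.coe_mul, ENNReal.coe_pow, ENNReal.coe_toNNReal hK', mul_assoc]

end Quintilinear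

theorem eLpNorm_two_sq {α : Type*} [MeasurableSpace α] {μ : Measure α} (f : α → ℂ) :
    eLpNorm f 2 μ ^ 2 = ∫⁻ x, ‖f x‖ₑ ^ 2 ∂μ := by
  have h := eLpNorm_nnreal_pow_eq_lintegral (f := f) (μ := μ) (p := 2) (by norm_num)
  simpa [ENNReal.rpow_ofNat] using h

/-! ### Fourier majorants for the quintic product -/

section FourierQuintic

variable {E : Type*} [NormedAddCommGroup E] [InnerProductSpace ℝ E] [FiniteDimensional ℝ E]
  [MeasurableSpace E] [BorelSpace E]

theorem enorm_fourier_mul_le {p q : Lp ℂ 2 (volume : Measure E)} {f g : E → ℝ≥0∞}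
    (hf : ∀ᵐ ζ, ‖(𝓕 p : Lp ℂ 2 (volume : Measure E)) ζ‖ₑ ≤ f ζ)
    (hg : ∀ᵐ ζ, ‖(𝓕 q : Lp ℂ 2 (volume : Measure E)) ζ‖ₑ ≤ g ζ) (ζ : E) :
    ‖𝓕 (fun x => p x * q x) ζ‖ₑ ≤ (f ⋆ₗ g) ζ := by
  rw [fourier_mul_lp_two, lconvolution_def]
  refine (enorm_integral_le_lintegral_enorm _).trans (lintegral_mono_ae ?_)
  have hm := (Measure.measurePreserving_sub_left (volume : Measure E) ζ).quasiMeasurePreserving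
  filter_upwards [hf, hm.ae hg] with η h1 h2
  rw [enorm_mul, neg_add_eq_sub]
  gcongr

/-- The product is integrable and its transform is dominated by a square integrable convolution, so
the product is again in `L²` with a known majorant. This makes the product bound iterable. -/
theorem memLp_two_mul_of_fourier {p q : Lp ℂ 2 (volume : Measure E)} {f g : E → ℝ≥0∞}
    (hf : ∀ᵐ ζ, ‖(𝓕 p : Lp ℂ 2 (volume : Measure E)) ζ‖ₑ ≤ f ζ)
    (hg : ∀ᵐ ζ, ‖(𝓕 q : Lp ℂ 2 (volume : Measure E)) ζ‖ₑ ≤ g ζ)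
    (hfg : ∫⁻ ζ, (f ⋆ₗ g) ζ ^ 2 ≠ ∞) :
    ∃ h : MemLp (fun x => p x * q x) 2 volume,
      ∀ᵐ ζ, ‖(𝓕 (h.toLp _) : Lp ℂ 2 (volume : Measure E)) ζ‖ₑ ≤ (f ⋆ₗ g) ζ := by
  have hle := enorm_fourier_mul_le hf hg
  have hint : Integrable (fun x => p x * q x) volume := (Lp.memLp p).integrable_mul (Lp.memLp q)
  have hmem : MemLp (𝓕 fun x => p x * q x) 2 volume := by
    refine ⟨(continuous_fourier_of_integrable hint).aestronglyMeasurable, ?_⟩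
    have : eLpNorm (𝓕 fun x => p x * q x) 2 volume ^ 2 < ∞ := by
      rw [eLpNorm_two_sq]
      refine lt_of_le_of_lt (lintegral_mono fun ζ => ?_) hfg.lt_top
      exact pow_le_pow_left₀ zero_le (hle ζ) 2
    exact (ENNReal.pow_lt_top_iff.1 this).resolve_right (by norm_num)
  obtain ⟨h, hF⟩ := memLp_two_of_fourier hint hmem
  refine ⟨h, ?_⟩
  filter_upwards [hF] with ζ hζ
  rw [hζ]
  exact hle ζ

/-- The Fourier transform of `|u|⁴u = (u u ū)(u ū)` is bounded by a fivefold convolution. -/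
theorem integrable_quintic_and_enorm_fourier_le (u : Lp ℂ 2 (volume : Measure E))
    {f : E → ℝ≥0∞} (hf : ∀ᵐ ζ, ‖(𝓕 u : Lp ℂ 2 (volume : Measure E)) ζ‖ₑ ≤ f ζ)
    (h₂ : ∫⁻ ζ, (f ⋆ₗ f) ζ ^ 2 ≠ ∞) (h₂' : ∫⁻ ζ, (f ⋆ₗ fun x => f (-x)) ζ ^ 2 ≠ ∞)
    (h₃ : ∫⁻ ζ, ((f ⋆ₗ f) ⋆ₗ fun x => f (-x)) ζ ^ 2 ≠ ∞) :
    Integrable (fun x => quintic (u x)) volume ∧ ∀ ζ, ‖𝓕 (fun x => quintic (u x)) ζ‖ₑ ≤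
      (((f ⋆ₗ f) ⋆ₗ fun x => f (-x)) ⋆ₗ (f ⋆ₗ fun x => f (-x))) ζ := by
  set v : Lp ℂ 2 (volume : Measure E) := (memLp_two_conj (Lp.memLp u)).toLp _ with hv
  have hvf : ∀ᵐ ζ, ‖(𝓕 v : Lp ℂ 2 (volume : Measure E)) ζ‖ₑ ≤ f (-ζ) := by
    have hn := (Measure.measurePreserving_neg (volume : Measure E)).quasiMeasurePreserving
    filter_upwards [lp_two_fourier_conj u, hn.ae hf] with ζ h1 h2
    rw [h1, RCLike.enorm_conj]
    exact h2
  obtain ⟨hH, hHle⟩ := memLp_two_mul_of_fourier hf hf h₂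
  obtain ⟨hP, hPle⟩ := memLp_two_mul_of_fourier hHle hvf h₃
  obtain ⟨hQ, hQle⟩ := memLp_two_mul_of_fourier hf hvf h₂'
  have hae : (fun x => hP.toLp _ x * hQ.toLp _ x) =ᵐ[volume] fun x => quintic (u x) := by
    filter_upwards [hP.coeFn_toLp, hQ.coeFn_toLp, hH.coeFn_toLp,
      (memLp_two_conj (Lp.memLp u)).coeFn_toLp] with x h1 h2 h3 h4
    rw [h1, h2, h3, hv, h4, quintic]
    have h5 : u x * (starRingEnd ℂ) (u x) = (‖u x‖ : ℂ) ^ 2 := by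
      rw [Complex.mul_conj, Complex.normSq_eq_norm_sq]
      push_cast
      rfl
    linear_combination (u x * (u x * (starRingEnd ℂ) (u x)) + (‖u x‖ : ℂ) ^ 2 * u x) * h5
  refine ⟨((Lp.memLp _).integrable_mul (Lp.memLp _)).congr hae, fun ζ => ?_⟩
  rw [← Real.fourier_congr_ae hae]
  exact enorm_fourier_mul_le hPle hQle ζ

/-- The bracketing of the convolution mirrors the factorisation `(u u ū)(u ū)`; Tonelli's theorem
and translations unfold it into the symmetric five-variable form. -/
theorem lintegral_mul_five_lconvolution {w : E → ℝ≥0∞} {F : Fin 5 → E → ℝ≥0∞}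
    (hw : Measurable w) (hF : ∀ i, Measurable (F i)) :
    ∫⁻ ζ, w ζ * (((F 0 ⋆ₗ F 1) ⋆ₗ F 2) ⋆ₗ (F 3 ⋆ₗ F 4)) ζ =
      ∫⁻ x : Fin 5 → E, w (∑ i, x i) * ∏ i, F i (x i) := by
  have h0 := hF 0
  have h1 := hF 1
  have h2 := hF 2
  have h3 := hF 3
  have h4 := hF 4
  have c01 : Measurable (F 0 ⋆ₗ F 1) := measurable_lconvolution _ h0 h1
  have c012 : Measurable ((F 0 ⋆ₗ F 1) ⋆ₗ F 2) := measurable_lconvolution _ c01 h2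
  have c34 : Measurable (F 3 ⋆ₗ F 4) := measurable_lconvolution _ h3 h4
  have hV : ∀ x, ∫⁻ y, (F 3 ⋆ₗ F 4) y * w (x + y) =
      ∫⁻ y, F 3 y * ∫⁻ z, F 4 z * w (x + (y + z)) := fun x => by
    rw [← lintegral_mul_lconvolution (w := fun y => w (x + y)) (by fun_prop) h3 h4]
    simp only [mul_comm]
  rw [lintegral_mul_lconvolution hw c012 c34]
  simp only [hV]
  set V : E → ℝ≥0∞ := fun x => ∫⁻ y, F 3 y * ∫⁻ z, F 4 z * w (x + (y + z)) with hVd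
  have hVm : Measurable V := by fun_prop
  have e1 : ∫⁻ x, ((F 0 ⋆ₗ F 1) ⋆ₗ F 2) x * V x =
      ∫⁻ z, (F 0 ⋆ₗ F 1) z * ∫⁻ x₂, F 2 x₂ * V (z + x₂) := by
    rw [← lintegral_mul_lconvolution hVm c01 h2]
    simp only [mul_comm]
  have e2 : ∫⁻ z, (F 0 ⋆ₗ F 1) z * ∫⁻ x₂, F 2 x₂ * V (z + x₂) =
      ∫⁻ x₀, F 0 x₀ * ∫⁻ x₁, F 1 x₁ * ∫⁻ x₂, F 2 x₂ * V (x₀ + x₁ + x₂) := by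
    rw [← lintegral_mul_lconvolution (w := fun z => ∫⁻ x₂, F 2 x₂ * V (z + x₂)) (by fun_prop) h0 h1]
    simp only [mul_comm]
  rw [e1, e2, lintegral_pi_fin_five (by fun_prop)]
  refine lintegral_congr fun x₀ => ?_
  rw [← lintegral_const_mul _ (by fun_prop)]
  refine lintegral_congr fun x₁ => ?_
  rw [← mul_assoc, ← lintegral_const_mul _ (by fun_prop)]
  refine lintegral_congr fun x₂ => ?_
  rw [← mul_assoc, hVd]
  simp only
  rw [← lintegral_const_mul _ (by fun_prop)]
  refine lintegral_congr fun x₃ => ?_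
  rw [← mul_assoc, ← lintegral_const_mul _ (by fun_prop)]
  refine lintegral_congr fun x₄ => ?_
  simp only [Fin.sum_univ_five, Fin.prod_univ_five, Matrix.cons_val]
  rw [show x₀ + x₁ + x₂ + (x₃ + x₄) = x₀ + x₁ + x₂ + x₃ + x₄ by abel]
  ring

end FourierQuintic

/-! ### Square integrability of partial products and the fivefold convolution estimate -/

section QuinticEstimate

/-- The function `⟨k⟩^{-s} ⟨e ω + k²⟩^{-q/2} φ`. -/
def weighted (s q e : ℝ) (φ : SpaceTime → ℝ≥0∞) (ζ : SpaceTime) : ℝ≥0∞ :=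
  bracketPow (-s) (spatialFreq ζ) * (bracketPow (-q / 2) (modulation e ζ) * φ ζ)

theorem measurable_weighted (s q e : ℝ) {φ : SpaceTime → ℝ≥0∞} (hφ : Measurable φ) :
    Measurable (weighted s q e φ) := by
  unfold weighted
  fun_prop

theorem weighted_neg (s q e : ℝ) (φ : SpaceTime → ℝ≥0∞) (ζ : SpaceTime) :
    weighted s q e φ (-ζ) = weighted s q (-e) (fun x => φ (-x)) ζ := by
  rw [weighted, weighted, spatialFreq_neg, bracketPow_neg, modulation_neg]

/-- A product of three numbers is at most the cube of the largest, hence at most the sum of the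
cubes. -/
theorem bracketPow_neg_mul_three_le (s x y z : ℝ) :
    bracketPow (-s) x * bracketPow (-s) y * bracketPow (-s) z ≤
      bracketPow (-(3 * s)) x + bracketPow (-(3 * s)) y + bracketPow (-(3 * s)) z := by
  have h : ∀ t, bracketPow (-(3 * s)) t = bracketPow (-s) t * bracketPow (-s) t * bracketPow (-s) t :=
    fun t => by rw [bracketPow_mul, bracketPow_mul]; congr 1; ring
  simp only [h]
  set a := bracketPow (-s) x
  set b := bracketPow (-s) y
  set c := bracketPow (-s) z
  have h3 : ∀ m, a ≤ m → b ≤ m → c ≤ m → a * b * c ≤ m * m * m := fun m h₁ h₂ h₃ =>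
    mul_le_mul' (mul_le_mul' h₁ h₂) h₃
  rcases le_total a b with hab | hab <;> rcases le_total b c with hbc | hbc <;>
    rcases le_total a c with hac | hac
  all_goals first
    | exact (h3 c ‹_› ‹_› le_rfl).trans le_add_self
    | exact ((h3 b ‹_› le_rfl ‹_›).trans le_add_self).trans le_self_add
    | exact ((h3 a le_rfl ‹_› ‹_›).trans le_self_add).trans le_self_add
    | exact (h3 c (hab.trans hbc) ‹_› le_rfl).trans le_add_self
    | exact ((h3 a le_rfl ‹_› (hbc.trans hab)).trans le_self_add).trans le_self_add

theorem weighted_mul_three_le (s q e₁ e₂ e₃ : ℝ)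
    (φ₁ φ₂ φ₃ : SpaceTime → ℝ≥0∞) (x y z : SpaceTime) :
    weighted s q e₁ φ₁ x * weighted s q e₂ φ₂ y * weighted s q e₃ φ₃ z ≤
      weighted (3 * s) q e₁ φ₁ x * weighted 0 q e₂ φ₂ y * weighted 0 q e₃ φ₃ z +
      weighted 0 q e₁ φ₁ x * weighted (3 * s) q e₂ φ₂ y * weighted 0 q e₃ φ₃ z +
      weighted 0 q e₁ φ₁ x * weighted 0 q e₂ φ₂ y * weighted (3 * s) q e₃ φ₃ z := by
  simp only [weighted, neg_zero, bracketPow_zero, one_mul]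
  set X := bracketPow (-q / 2) (modulation e₁ x) * φ₁ x
  set Y := bracketPow (-q / 2) (modulation e₂ y) * φ₂ y
  set Z := bracketPow (-q / 2) (modulation e₃ z) * φ₃ z
  calc _ = (bracketPow (-s) (spatialFreq x) * bracketPow (-s) (spatialFreq y) *
        bracketPow (-s) (spatialFreq z)) * (X * Y * Z) := by ring
    _ ≤ _ := mul_le_mul' (bracketPow_neg_mul_three_le _ _ _ _) le_rfl
    _ = _ := by ring

theorem lconvolution_three_apply {f g : SpaceTime → ℝ≥0∞} (h : SpaceTime → ℝ≥0∞) (hf : Measurable f)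
    (hg : Measurable g) (ζ : SpaceTime) :
    ((f ⋆ₗ g) ⋆ₗ h) ζ = ∫⁻ y, ∫⁻ x, f x * g (-x + y) * h (-y + ζ) := by
  simp only [lconvolution_def]
  refine lintegral_congr fun y => ?_
  rw [lintegral_mul_const _ (by fun_prop)]

theorem lintegral_sq_weighted_two_lt_top {s q : ℝ} (hs : 0 ≤ s) (hq : 1 < q) {e₁ e₂ : ℝ}
    (he₁ : e₁ ^ 2 = 1) (he₂ : e₂ ^ 2 = 1) {φ₁ φ₂ : SpaceTime → ℝ≥0∞} (h₁ : Measurable φ₁)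
    (h₂ : Measurable φ₂) (hφ₁ : ∫⁻ ζ, φ₁ ζ ^ 2 < ∞) (hφ₂ : ∫⁻ ζ, φ₂ ζ ^ 2 < ∞) :
    ∫⁻ ζ, (weighted s q e₁ φ₁ ⋆ₗ weighted s q e₂ φ₂) ζ ^ 2 < ∞ := by
  obtain ⟨C, hC⟩ := lintegral_sq_lconvolution_weighted_le (by linarith : 1 / 2 < q) le_rfl hq
  refine lt_of_le_of_lt (lintegral_mono fun ζ => ?_) ((hC e₁ e₂ he₁ he₂ φ₁ φ₂ h₁ h₂).trans_lt
    (ENNReal.mul_lt_top (ENNReal.mul_lt_top ENNReal.coe_lt_top hφ₁) hφ₂))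
  refine pow_le_pow_left₀ zero_le ?_ 2
  have hw : ∀ (e : ℝ) (φ : SpaceTime → ℝ≥0∞) x, weighted s q e φ x ≤
      bracketPow (-q / 2) (modulation e x) * φ x := fun e φ x => by
    refine mul_le_of_le_one_left' ?_
    rw [← bracketPow_zero (spatialFreq x)]
    exact bracketPow_mono (by linarith) _
  simp only [lconvolution_def]
  gcongr
  · exact hw _ _ _
  · exact hw _ _ _

/-- Concentrating the whole spatial decay `⟨k⟩^{-3s}` on one factor makes that factor integrable.
Young's inequality then reduces to the bilinear `L²` bound for the other two. -/
theorem lintegral_sq_weighted_three_lt_top {s q : ℝ} (hs : 1 / 3 < s) (hq : 1 < q)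
    {e₁ e₂ e₃ : ℝ} (he₁ : e₁ ^ 2 = 1) (he₂ : e₂ ^ 2 = 1) (he₃ : e₃ ^ 2 = 1)
    {φ₁ φ₂ φ₃ : SpaceTime → ℝ≥0∞} (h₁ : Measurable φ₁) (h₂ : Measurable φ₂) (h₃ : Measurable φ₃)
    (hφ₁ : ∫⁻ ζ, φ₁ ζ ^ 2 < ∞) (hφ₂ : ∫⁻ ζ, φ₂ ζ ^ 2 < ∞) (hφ₃ : ∫⁻ ζ, φ₃ ζ ^ 2 < ∞) :
    ∫⁻ ζ, ((weighted s q e₁ φ₁ ⋆ₗ weighted s q e₂ φ₂) ⋆ₗ weighted s q e₃ φ₃) ζ ^ 2 < ∞ := by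
  obtain ⟨C, hC⟩ := sq_lintegral_weighted_le (by linarith : 1 / 2 < 3 * s) hq
  have hL : ∀ (e : ℝ) (φ : SpaceTime → ℝ≥0∞), e ^ 2 = 1 → Measurable φ → ∫⁻ ζ, φ ζ ^ 2 < ∞ →
      (∫⁻ ζ, weighted (3 * s) q e φ ζ) ^ 2 < ∞ := fun e φ he h hφ =>
    (hC e he φ h).trans_lt (ENNReal.mul_lt_top ENNReal.coe_lt_top hφ)
  have m : ∀ (t e : ℝ) {φ : SpaceTime → ℝ≥0∞}, Measurable φ → Measurable (weighted t q e φ) :=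
    fun t e φ h => measurable_weighted t q e h
  set A₁ := weighted (3 * s) q e₁ φ₁ ⋆ₗ (weighted 0 q e₂ φ₂ ⋆ₗ weighted 0 q e₃ φ₃) with hA₁
  set A₂ := weighted (3 * s) q e₂ φ₂ ⋆ₗ (weighted 0 q e₁ φ₁ ⋆ₗ weighted 0 q e₃ φ₃) with hA₂
  set A₃ := weighted (3 * s) q e₃ φ₃ ⋆ₗ (weighted 0 q e₁ φ₁ ⋆ₗ weighted 0 q e₂ φ₂) with hA₃
  have key : ∀ {e e' e'' : ℝ} {φ φ' φ'' : SpaceTime → ℝ≥0∞}, e ^ 2 = 1 → e' ^ 2 = 1 → e'' ^ 2 = 1 →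
      Measurable φ → Measurable φ' → Measurable φ'' → ∫⁻ ζ, φ ζ ^ 2 < ∞ → ∫⁻ ζ, φ' ζ ^ 2 < ∞ →
      ∫⁻ ζ, φ'' ζ ^ 2 < ∞ →
      Measurable (weighted (3 * s) q e φ ⋆ₗ (weighted 0 q e' φ' ⋆ₗ weighted 0 q e'' φ'')) ∧
      ∫⁻ ζ, (weighted (3 * s) q e φ ⋆ₗ (weighted 0 q e' φ' ⋆ₗ weighted 0 q e'' φ'')) ζ ^ 2 < ∞ := by
    intro e e' e'' φ φ' φ'' he he' he'' h h' h'' hφ hφ' hφ''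
    have hc := measurable_lconvolution (volume : Measure SpaceTime) (m 0 e' h') (m 0 e'' h'')
    refine ⟨measurable_lconvolution _ (m _ _ h) hc, ?_⟩
    refine (lintegral_sq_lconvolution_le (m _ _ h) hc).trans_lt (ENNReal.mul_lt_top (hL e φ he h hφ) ?_)
    exact lintegral_sq_weighted_two_lt_top le_rfl hq he' he'' h' h'' hφ' hφ''
  obtain ⟨m₁, f₁⟩ := key he₁ he₂ he₃ h₁ h₂ h₃ hφ₁ hφ₂ hφ₃
  obtain ⟨m₂, f₂⟩ := key he₂ he₁ he₃ h₂ h₁ h₃ hφ₂ hφ₁ hφ₃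
  obtain ⟨m₃, f₃⟩ := key he₃ he₁ he₂ h₃ h₁ h₂ hφ₃ hφ₁ hφ₂
  have hpt : ∀ ζ, ((weighted s q e₁ φ₁ ⋆ₗ weighted s q e₂ φ₂) ⋆ₗ weighted s q e₃ φ₃) ζ ≤
      A₁ ζ + A₂ ζ + A₃ ζ := by
    intro ζ
    have r₁ : A₁ = (weighted (3 * s) q e₁ φ₁ ⋆ₗ weighted 0 q e₂ φ₂) ⋆ₗ weighted 0 q e₃ φ₃ :=
      lconvolution_assoc (m _ _ h₁) (m _ _ h₂) (m _ _ h₃)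
    have r₂ : A₂ = (weighted 0 q e₁ φ₁ ⋆ₗ weighted (3 * s) q e₂ φ₂) ⋆ₗ weighted 0 q e₃ φ₃ := by
      rw [hA₂, lconvolution_assoc (m _ _ h₂) (m _ _ h₁) (m _ _ h₃),
        lconvolution_comm (f := weighted (3 * s) q e₂ φ₂)]
    have r₃ : A₃ = (weighted 0 q e₁ φ₁ ⋆ₗ weighted 0 q e₂ φ₂) ⋆ₗ weighted (3 * s) q e₃ φ₃ :=
      lconvolution_comm
    rw [r₁, r₂, r₃]
    have n₁ := m s e₁ h₁
    have n₂ := m s e₂ h₂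
    have n₃ := m s e₃ h₃
    have z₁ := m 0 e₁ h₁
    have z₂ := m 0 e₂ h₂
    have z₃ := m 0 e₃ h₃
    have t₁ := m (3 * s) e₁ h₁
    have t₂ := m (3 * s) e₂ h₂
    have t₃ := m (3 * s) e₃ h₃
    rw [lconvolution_three_apply _ n₁ n₂, lconvolution_three_apply _ t₁ z₂,
      lconvolution_three_apply _ z₁ t₂, lconvolution_three_apply _ z₁ z₂,
      ← lintegral_add_left (by fun_prop), ← lintegral_add_left (by fun_prop)]
    refine lintegral_mono fun y => ?_
    rw [← lintegral_add_left (by fun_prop), ← lintegral_add_left (by fun_prop)]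
    exact lintegral_mono fun x => weighted_mul_three_le _ _ _ _ _ _ _ _ _ _ _
  calc _ ≤ ∫⁻ ζ, 2 * (2 * (A₁ ζ ^ 2 + A₂ ζ ^ 2) + A₃ ζ ^ 2) := by
        refine lintegral_mono fun ζ => ?_
        refine (pow_le_pow_left₀ zero_le (hpt ζ) 2).trans ((add_sq_le_two_mul _ _).trans ?_)
        gcongr
        exact add_sq_le_two_mul _ _
    _ = 2 * (2 * ((∫⁻ ζ, A₁ ζ ^ 2) + ∫⁻ ζ, A₂ ζ ^ 2) + ∫⁻ ζ, A₃ ζ ^ 2) := by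
        rw [lintegral_const_mul _ (by fun_prop), lintegral_add_left (by fun_prop),
          lintegral_const_mul _ (by fun_prop), lintegral_add_left (by fun_prop)]
    _ < ∞ := by
        refine ENNReal.mul_lt_top (by simp) (ENNReal.add_lt_top.2 ⟨ENNReal.mul_lt_top (by simp)
          (ENNReal.add_lt_top.2 ⟨f₁, f₂⟩), f₃⟩)

/-- The quintilinear estimate for the fivefold convolution of `f = ⟨k⟩^{-s}⟨σ⟩^{-q/2} φ`. -/
theorem lintegral_sq_five_lconvolution_le {s p q q' a : ℝ} (hs : 1 / 3 < s) (hp : 1 / 2 < p)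
    (hpq : p ≤ q) (hq : 1 < q) (hpq' : p ≤ q') (hq' : 1 < q') (ha : 0 ≤ a) (has : a ≤ s)
    (hapq : 2 * (q' - p) + 2 * a ≤ 1) :
    ∃ C : ℝ≥0, ∀ φ : SpaceTime → ℝ≥0∞, Measurable φ → ∀ f : SpaceTime → ℝ≥0∞,
      f = weighted s q 1 φ →
      ∫⁻ ζ, (bracketPow (s + a) (spatialFreq ζ) * (bracketPow (-p / 2) (modulation 1 ζ) *
        (((f ⋆ₗ f) ⋆ₗ fun x => f (-x)) ⋆ₗ (f ⋆ₗ fun x => f (-x))) ζ)) ^ 2 ≤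
        C * (∫⁻ ζ, φ ζ ^ 2) ^ 5 := by
  obtain ⟨C, hC⟩ := lintegral_five_le hs hp hpq hq hpq' hq' ha has hapq
  refine ⟨C, fun φ hφ f hf => ?_⟩
  set ψ : SpaceTime → ℝ≥0∞ := fun x => φ (-x) with hψ
  have hψm : Measurable ψ := by fun_prop
  have hn : ∫⁻ ζ, ψ ζ ^ 2 = ∫⁻ ζ, φ ζ ^ 2 := lintegral_neg_eq_self (fun ζ => φ ζ ^ 2)
  have hg : (fun x => f (-x)) = weighted s q (-1) ψ := by
    funext x
    rw [hf, weighted_neg]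
  -- The third and fifth factors are the conjugates: their transforms are reflected, which changes
  -- the sign in the modulation.
  set e : Fin 5 → ℝ := ![1, 1, -1, 1, -1] with he
  set Φ : Fin 5 → SpaceTime → ℝ≥0∞ := ![φ, φ, ψ, φ, ψ] with hΦ
  have hΦm : ∀ i, Measurable (Φ i) := by
    intro i
    fin_cases i <;> simpa [hΦ]
  have he2 : ∀ i, e i ^ 2 = 1 := by
    intro i
    fin_cases i <;> simp [he]
  have hFm : ∀ i, Measurable (weighted s q (e i) (Φ i)) := fun i =>
    measurable_weighted s q (e i) (hΦm i)
  have hprod : ∏ i, ∫⁻ ζ, Φ i ζ ^ 2 = (∫⁻ ζ, φ ζ ^ 2) ^ 5 := by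
    simp only [Fin.prod_univ_five, hΦ, Matrix.cons_val, hn]
    ring
  have hfm : Measurable f := hf ▸ measurable_weighted s q 1 hφ
  have hconv : ((f ⋆ₗ f) ⋆ₗ fun x => f (-x)) ⋆ₗ (f ⋆ₗ fun x => f (-x)) =
      ((weighted s q (e 0) (Φ 0) ⋆ₗ weighted s q (e 1) (Φ 1)) ⋆ₗ weighted s q (e 2) (Φ 2)) ⋆ₗ
        (weighted s q (e 3) (Φ 3) ⋆ₗ weighted s q (e 4) (Φ 4)) := by
    rw [hg, hf]
    rfl
  have hQm : Measurable (((f ⋆ₗ f) ⋆ₗ fun x => f (-x)) ⋆ₗ (f ⋆ₗ fun x => f (-x))) := by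
    have hgm : Measurable fun x => f (-x) := by fun_prop
    exact measurable_lconvolution _ (measurable_lconvolution _ (measurable_lconvolution _ hfm hfm) hgm)
      (measurable_lconvolution _ hfm hgm)
  refine lintegral_sq_le_of_forall_mul (by fun_prop) fun w hw => ?_
  have h := hC e he2 w Φ hw hΦm
  rw [hprod, mul_comm (∫⁻ ζ, w ζ ^ 2), ← mul_assoc] at h
  refine le_trans (le_of_eq ?_) h
  congr 1
  have h5 := lintegral_mul_five_lconvolution (w := fun ζ => bracketPow (s + a) (spatialFreq ζ) *
    (bracketPow (-p / 2) (modulation 1 ζ) * w ζ)) (F := fun i => weighted s q (e i) (Φ i))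
    (by fun_prop) hFm
  refine Eq.trans (lintegral_congr fun ζ => ?_) h5
  rw [hconv]
  ring

end QuinticEstimate

/-! ### The quintilinear estimate in Bourgain spaces -/

section QuinticBourgain

/-- The weight `⟨ω + k²⟩^b ⟨k⟩^s` of the Bourgain norm. -/
def bourgainWeight (s b : ℝ) (ζ : SpaceTime) : ℝ :=
  japaneseBracket (2 * Real.pi * ζ.fst + (2 * Real.pi * ζ.snd) ^ 2) ^ b *
    japaneseBracket (2 * Real.pi * ζ.snd) ^ s

theorem enorm_bourgainWeight_mul (s b : ℝ) (ζ : SpaceTime) (z : ℂ) :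
    ‖(bourgainWeight s b ζ : ℂ) * z‖ₑ =
      bracketPow s (spatialFreq ζ) * (bracketPow b (modulation 1 ζ) * ‖z‖ₑ) := by
  rw [bourgainWeight, Complex.ofReal_mul, enorm_mul, enorm_mul, ← bracketPow_eq_enorm,
    ← bracketPow_eq_enorm, modulation, spatialFreq, one_mul]
  ring

theorem bourgainNorm_sq (s b : ℝ) (u : Lp ℂ 2 (volume : Measure SpaceTime)) :
    bourgainNorm s b u ^ 2 = ∫⁻ ζ, (bracketPow s (spatialFreq ζ) * (bracketPow b (modulation 1 ζ) *
      ‖(𝓕 u : Lp ℂ 2 (volume : Measure SpaceTime)) ζ‖ₑ)) ^ 2 := by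
  rw [bourgainNorm, weightedFourierNorm_lp_two, eLpNorm_two_sq]
  exact lintegral_congr fun ζ => by rw [← enorm_bourgainWeight_mul, bourgainWeight]

/-- The quintilinear estimate, for the Fourier transform of the integrable function `|u|⁴u`. -/
theorem eLpNorm_bourgainWeight_fourier_quintic_le {s a : ℝ} (hs : 1 / 3 < s)
    (ha : a < min (3 * s - 1) (1 / 2)) :
    ∃ δ₀ : ℝ, 0 < δ₀ ∧ ∀ δ : ℝ, 0 < δ → δ < δ₀ → ∀ ε : ℝ, 0 < ε → ∃ C : ℝ≥0,
      ∀ u : Lp ℂ 2 (volume : Measure SpaceTime), bourgainNorm s (1 / 2 + ε) u ≠ ∞ →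
        Integrable (fun z => quintic (u z)) volume ∧
        eLpNorm (fun ζ => (bourgainWeight (s + a) (-1 / 2 + δ) ζ : ℂ) *
          𝓕 (fun z => quintic (u z)) ζ) 2 volume ≤ C * bourgainNorm s (1 / 2 + ε) u ^ 5 := by
  obtain ⟨ha₁, ha₂⟩ := lt_min_iff.1 ha
  -- Negative `a` reduces to `a' = 0` by monotonicity of bracket powers.
  set a' := max a 0 with ha'
  have h0 : 0 ≤ a' := le_max_right _ _
  have h1 : a ≤ a' := le_max_left _ _
  have h2 : a' < 1 / 2 := max_lt ha₂ (by norm_num)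
  have h3 : a' < 3 * s - 1 := max_lt ha₁ (by linarith)
  -- For `s ≤ 1/2` one has `3s - 1 ≤ s`, and for `s ≥ 1/2` the bound `a' < 1/2` is enough.
  have h4 : a' ≤ s := by
    rcases le_total s (1 / 2) with h | h <;> linarith
  -- With `p = 1 - 2δ` and `q' = 1 + δ` the condition `2 (q' - p) + 2 a' ≤ 1` reads `6δ + 2a' ≤ 1`.
  refine ⟨(1 - 2 * a') / 6, by linarith, fun δ hδ hδ₀ ε hε => ?_⟩
  obtain ⟨C, hC⟩ := lintegral_sq_five_lconvolution_le (p := 1 - 2 * δ) (q := 1 + 2 * ε)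
    (q' := 1 + δ) hs (by linarith) (by linarith) (by linarith) (by linarith) (by linarith) h0 h4
    (by linarith)
  refine ⟨NNReal.sqrt C, fun u hu => ?_⟩
  set U : SpaceTime → ℝ≥0∞ := fun ζ => ‖(𝓕 u : Lp ℂ 2 (volume : Measure SpaceTime)) ζ‖ₑ with hU
  have hUm : Measurable U := (Lp.stronglyMeasurable _).measurable.enorm
  set φ : SpaceTime → ℝ≥0∞ := fun ζ => bracketPow s (spatialFreq ζ) *
    (bracketPow (1 / 2 + ε) (modulation 1 ζ) * U ζ) with hφ
  have hφm : Measurable φ := by fun_prop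
  have hUφ : U = weighted s (1 + 2 * ε) 1 φ := by
    funext ζ
    rw [weighted, hφ, show -(1 + 2 * ε) / 2 = -(1 / 2 + ε) by ring]
    calc U ζ = (bracketPow (-s) (spatialFreq ζ) * bracketPow s (spatialFreq ζ)) *
          ((bracketPow (-(1 / 2 + ε)) (modulation 1 ζ) * bracketPow (1 / 2 + ε) (modulation 1 ζ)) *
            U ζ) := by
          rw [bracketPow_neg_mul_cancel, bracketPow_neg_mul_cancel, one_mul, one_mul]
      _ = _ := by ring
  have hφn : ∫⁻ ζ, φ ζ ^ 2 = bourgainNorm s (1 / 2 + ε) u ^ 2 := (bourgainNorm_sq _ _ _).symm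
  have hφf : ∫⁻ ζ, φ ζ ^ 2 < ∞ := by
    rw [hφn]
    exact ENNReal.pow_lt_top hu.lt_top
  set ψ : SpaceTime → ℝ≥0∞ := fun ζ => φ (-ζ) with hψ
  have hψm : Measurable ψ := by fun_prop
  have hψf : ∫⁻ ζ, ψ ζ ^ 2 < ∞ := by
    rwa [hψ, lintegral_neg_eq_self (fun ζ => φ ζ ^ 2)]
  have hV : (fun ζ => U (-ζ)) = weighted s (1 + 2 * ε) (-1) ψ := by
    funext ζ
    rw [hUφ, weighted_neg]
  have hs0 : 0 ≤ s := by linarith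
  have hq : 1 < 1 + 2 * ε := by linarith
  have e1 : (1 : ℝ) ^ 2 = 1 := by norm_num
  have e2 : (-1 : ℝ) ^ 2 = 1 := by norm_num
  obtain ⟨hint, hle⟩ := integrable_quintic_and_enorm_fourier_le u (f := U)
    (Eventually.of_forall fun _ => le_rfl)
    (by rw [hUφ]; exact (lintegral_sq_weighted_two_lt_top hs0 hq e1 e1 hφm hφm hφf hφf).ne)
    (by rw [hV, hUφ]; exact (lintegral_sq_weighted_two_lt_top hs0 hq e1 e2 hφm hψm hφf hψf).ne)
    (by rw [hV, hUφ]; exact (lintegral_sq_weighted_three_lt_top hs hq e1 e1 e2 hφm hφm hψm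
      hφf hφf hψf).ne)
  refine ⟨hint, ?_⟩
  rw [← ENNReal.pow_le_pow_left_iff two_ne_zero, eLpNorm_two_sq]
  calc _ ≤ ∫⁻ ζ, (bracketPow (s + a') (spatialFreq ζ) *
        (bracketPow (-(1 - 2 * δ) / 2) (modulation 1 ζ) *
          (((U ⋆ₗ U) ⋆ₗ fun x => U (-x)) ⋆ₗ (U ⋆ₗ fun x => U (-x))) ζ)) ^ 2 := by
        refine lintegral_mono fun ζ => ?_
        rw [enorm_bourgainWeight_mul, show -(1 - 2 * δ) / 2 = -1 / 2 + δ by ring]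
        refine pow_le_pow_left₀ zero_le (mul_le_mul' (bracketPow_mono (by linarith) _)
          (mul_le_mul' le_rfl (hle ζ))) 2
    _ ≤ C * (∫⁻ ζ, φ ζ ^ 2) ^ 5 := hC φ hφm U hUφ
    _ = _ := by
        rw [hφn, mul_pow, ← ENNReal.coe_pow, NNReal.sq_sqrt]
        ring

theorem bourgainNorm_quintic_le {s a : ℝ} (hs : 1 / 3 < s)
    (ha : a < min (3 * s - 1) (1 / 2)) :
    ∃ δ₀ : ℝ, 0 < δ₀ ∧ ∀ δ : ℝ, 0 < δ → δ < δ₀ → ∀ ε : ℝ, 0 < ε → ∃ C : ℝ≥0,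
      ∀ u : Lp ℂ 2 (volume : Measure SpaceTime), bourgainNorm s (1 / 2 + ε) u ≠ ∞ →
        ∃ hu : MemLp (fun z => quintic (u z)) 1 volume,
          bourgainNorm (s + a) (-1 / 2 + δ) (hu.toLp _) ≤
            C * bourgainNorm s (1 / 2 + ε) u ^ 5 := by
  obtain ⟨δ₀, hδ₀, h⟩ := eLpNorm_bourgainWeight_fourier_quintic_le hs ha
  refine ⟨δ₀, hδ₀, fun δ hδ hδ' ε hε => ?_⟩
  obtain ⟨C, hC⟩ := h δ hδ hδ' ε hε
  refine ⟨C, fun u hu => ?_⟩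
  obtain ⟨h1, h2⟩ := hC u hu
  exact ⟨memLp_one_iff_integrable.2 h1, (weightedFourierNorm_toLp_one_le _ _).trans h2⟩

end QuinticBourgain

/-! ### Primitives in time via the Fourier transform -/

section TimeIntegral

open scoped Convolution

theorem convolution_indicator_eq {t : ℝ} (ht : 0 ≤ t) (g : ℝ → ℂ) (r : ℝ) :
    ((Set.Ioc (-t) 0).indicator (fun _ => (1 : ℂ)) ⋆[ContinuousLinearMap.mul ℂ ℂ] g) r =
      ∫ y in r..r + t, g y := by
  rw [convolution_def]
  have h : ∀ y, (ContinuousLinearMap.mul ℂ ℂ) ((Set.Ioc (-t) 0).indicator (fun _ => (1 : ℂ)) y)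
      (g (r - y)) = (Set.Ioc (-t) 0).indicator (fun y => g (r - y)) y := fun y => by
    by_cases hy : y ∈ Set.Ioc (-t) 0 <;> simp [hy]
  simp only [h]
  rw [integral_indicator measurableSet_Ioc, ← intervalIntegral.integral_of_le (by linarith),
    intervalIntegral.integral_comp_sub_left, sub_zero, sub_neg_eq_add]

theorem integrable_indicator_Ioc (a b : ℝ) :
    Integrable ((Set.Ioc a b).indicator fun _ => (1 : ℂ)) volume :=
  (integrable_indicator_iff measurableSet_Ioc).2 (integrableOn_const (by simp))

/-- The transform is at most `t` trivially and at most `2 / |ω|` by explicit integration of the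
exponential; the two bounds add up to `t + 2`. -/
theorem norm_fourier_indicator_Ioc_le {t : ℝ} (ht : 0 ≤ t) (σ : ℝ) :
    ‖𝓕 ((Set.Ioc (-t) 0).indicator fun _ => (1 : ℂ)) σ‖ * japaneseBracket (2 * Real.pi * σ) ≤
      t + 2 := by
  set K := 𝓕 ((Set.Ioc (-t) 0).indicator fun _ => (1 : ℂ)) σ with hK
  have h1 : ‖K‖ ≤ t := by
    refine (norm_fourier_le_integral_norm _ σ).trans (le_of_eq ?_)
    simp only [norm_indicator_eq_indicator_norm, norm_one]
    rw [integral_indicator measurableSet_Ioc]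
    simp [ht]
  have hKe : K = ∫ x in (-t)..0, Complex.exp (((-(2 * Real.pi * σ) : ℝ) : ℂ) * Complex.I * x) := by
    rw [hK, Real.fourier_real_eq_integral_exp_smul, intervalIntegral.integral_of_le (by linarith),
      ← integral_indicator measurableSet_Ioc]
    refine integral_congr_ae (Eventually.of_forall fun x => ?_)
    by_cases hx : x ∈ Set.Ioc (-t) 0
    · simp only [Set.indicator_of_mem hx, smul_eq_mul, mul_one]
      congr 1
      push_cast
      ring
    · simp [hx]
  have h2 : ‖K‖ * |2 * Real.pi * σ| ≤ 2 := by
    rcases eq_or_ne (2 * Real.pi * σ) 0 with h0 | h0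
    · rw [h0]
      simp
    · have hc : ((-(2 * Real.pi * σ) : ℝ) : ℂ) * Complex.I ≠ 0 :=
        mul_ne_zero (by exact_mod_cast neg_ne_zero.2 h0) Complex.I_ne_zero
      rw [hKe, integral_exp_mul_complex hc, norm_div, norm_mul, Complex.norm_I, mul_one,
        Complex.norm_real, norm_neg, Real.norm_eq_abs, div_mul_cancel₀ _ (abs_ne_zero.2 h0)]
      refine (norm_sub_le _ _).trans ?_
      have he : ∀ x : ℝ, ‖Complex.exp (((-(2 * Real.pi * σ) : ℝ) : ℂ) * Complex.I * x)‖ = 1 :=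
        fun x => by
          rw [mul_right_comm, ← Complex.ofReal_mul, Complex.norm_exp_ofReal_mul_I]
      rw [he, he]
      norm_num
  calc _ ≤ ‖K‖ * (1 + |2 * Real.pi * σ|) := by
        gcongr
        exact japaneseBracket_le_one_add_abs _
    _ ≤ t + 2 := by linarith

/-- The primitive of an integrable function is controlled by its Fourier transform with the
weight `⟨ω⟩^{-1}`. -/
theorem enorm_intervalIntegral_le {t : ℝ} (ht : 0 ≤ t) {g : ℝ → ℂ} (hg : Integrable g volume) :
    ‖∫ y in (0 : ℝ)..t, g y‖ₑ ≤
      ENNReal.ofReal (t + 2) * ∫⁻ σ : ℝ, ‖𝓕 g σ‖ₑ * bracketPow (-1) (2 * Real.pi * σ) := by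
  set χ : ℝ → ℂ := (Set.Ioc (-t) 0).indicator fun _ => (1 : ℂ) with hχ
  have hχi : Integrable χ volume := integrable_indicator_Ioc _ _
  -- The wanted primitive is the value at `0` of this convolution. `H` is continuous, so Fourier
  -- inversion holds at that point as soon as its transform is integrable.
  set H : ℝ → ℂ := χ ⋆[ContinuousLinearMap.mul ℂ ℂ] g with hH
  have hHi : Integrable H volume := hχi.integrable_convolution _ hg
  have hHe : H = fun r => (∫ y in (0 : ℝ)..(r + t), g y) - ∫ y in (0 : ℝ)..r, g y := by
    funext r
    rw [hH, convolution_indicator_eq ht, intervalIntegral.integral_interval_sub_left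
      hg.intervalIntegrable hg.intervalIntegrable]
  have hHc : Continuous H := by
    have := intervalIntegral.continuous_primitive (fun _ _ => hg.intervalIntegrable) (0 : ℝ)
      (f := g) (μ := volume)
    rw [hHe]
    fun_prop
  have hF : ∀ σ, 𝓕 H σ = 𝓕 χ σ * 𝓕 g σ := fun σ => Real.fourier_mul_convolution_eq hχi hg σ
  have hb : ∀ σ, ‖𝓕 H σ‖ₑ ≤
      ENNReal.ofReal (t + 2) * (‖𝓕 g σ‖ₑ * bracketPow (-1) (2 * Real.pi * σ)) := fun σ => by
    rw [hF, enorm_mul, mul_comm ‖𝓕 g σ‖ₑ, ← mul_assoc]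
    refine mul_le_mul' ?_ le_rfl
    have h := norm_fourier_indicator_Ioc_le ht σ
    rw [← le_div_iff₀ (japaneseBracket_pos _)] at h
    rw [← ofReal_norm, bracketPow, Real.rpow_neg_one, ← ENNReal.ofReal_mul (by linarith)]
    exact ENNReal.ofReal_le_ofReal h
  have hb' : ∫⁻ σ, ‖𝓕 H σ‖ₑ ≤
      ENNReal.ofReal (t + 2) * ∫⁻ σ : ℝ, ‖𝓕 g σ‖ₑ * bracketPow (-1) (2 * Real.pi * σ) := by
    rw [← lintegral_const_mul' _ _ ENNReal.ofReal_ne_top]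
    exact lintegral_mono hb
  -- If the transform is not integrable, the right-hand side is infinite and nothing is claimed.
  rcases eq_or_ne (∫⁻ σ, ‖𝓕 H σ‖ₑ) ∞ with htop | htop
  · rw [htop, top_le_iff] at hb'
    rw [hb']
    exact le_top
  · have hFi : Integrable (𝓕 H) volume :=
      ⟨(continuous_fourier_of_integrable hHi).aestronglyMeasurable, htop.lt_top⟩
    have hinv := hHi.fourierInv_fourier_eq hFi (hHc.continuousAt (x := 0))
    have h0 : H 0 = ∫ y in (0 : ℝ)..t, g y := by
      rw [hH, convolution_indicator_eq ht, zero_add]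
    rw [← h0, ← hinv, Real.fourierInv_eq']
    refine (enorm_integral_le_lintegral_enorm _).trans (le_trans (le_of_eq ?_) hb')
    refine lintegral_congr fun σ => ?_
    simp

end TimeIntegral

/-! ### The interaction profile and the Duhamel integral -/

section Profile

theorem continuous_freeSymbol (ξ : ℝ) : Continuous fun t => freeSymbol t ξ := by
  unfold freeSymbol
  fun_prop

theorem norm_freeSymbol (t ξ : ℝ) : ‖freeSymbol t ξ‖ = 1 := by
  rw [freeSymbol, Complex.norm_exp_ofReal_mul_I]

theorem freeSymbol_sub (t t' ξ : ℝ) : freeSymbol (t - t') ξ = freeSymbol t ξ * freeSymbol (-t') ξ := by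
  rw [freeSymbol, freeSymbol, freeSymbol, ← Complex.exp_add]
  congr 1
  push_cast
  ring

/-- The spatial Fourier transform of `F(t)` in the interaction picture, `e^{itk²} F̂(t)(ξ)`. -/
def profile (F : SpaceTime → ℂ) (ξ t : ℝ) : ℂ :=
  freeSymbol (-t) ξ * (𝓕 (fun x : ℝ => F (WithLp.toLp 2 (t, x))) : ℝ → ℂ) ξ

/-- The point of frequency space at which `𝓕 F` is the time Fourier transform of the profile. -/
def profilePoint (σ ξ : ℝ) : SpaceTime := WithLp.toLp 2 (σ - 2 * Real.pi * ξ ^ 2, ξ)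

theorem smul_profile_eq (F : SpaceTime → ℂ) (σ ξ t : ℝ) :
    Real.fourierChar (-(t * σ)) • profile F ξ t =
      ∫ x : ℝ, Real.fourierChar (-inner ℝ (WithLp.toLp 2 (t, x)) (profilePoint σ ξ)) •
        F (WithLp.toLp 2 (t, x)) := by
  rw [profile, Real.fourier_real_eq, Circle.smul_def, smul_eq_mul, ← mul_assoc,
    ← integral_const_mul]
  refine integral_congr_ae (Eventually.of_forall fun x => ?_)
  simp only [Circle.smul_def, smul_eq_mul, ← mul_assoc]
  congr 1
  rw [Real.fourierChar_apply, Real.fourierChar_apply, Real.fourierChar_apply, freeSymbol,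
    ← Complex.exp_add, ← Complex.exp_add, WithLp.prod_inner_apply]
  congr 1
  simp [profilePoint]
  ring

theorem integrable_fourierChar_smul_toLp {F : SpaceTime → ℂ} (hF : Integrable F volume)
    (w : SpaceTime) :
    Integrable (fun z : ℝ × ℝ => Real.fourierChar (-inner ℝ (WithLp.toLp 2 z) w) •
      F (WithLp.toLp 2 z)) (volume.prod volume) := by
  have h := (Real.fourierIntegral_convergent_iff w).2 hF
  exact (WithLp.volume_preserving_toLp ℝ ℝ).integrable_comp_of_integrable h

theorem integrable_profile {F : SpaceTime → ℂ} (hF : Integrable F volume) (ξ : ℝ) :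
    Integrable (profile F ξ) volume := by
  refine (integrable_fourierChar_smul_toLp hF (profilePoint 0 ξ)).integral_prod_left.congr
    (Eventually.of_forall fun t => ?_)
  simp only
  rw [← smul_profile_eq, mul_zero, neg_zero, AddChar.map_zero_eq_one, one_smul]

/-- Fubini: multiplication by `e^{itk²}` shifts the time frequency so that the modulation at
`profilePoint σ ξ` is exactly `2πσ`. -/
theorem fourier_profile {F : SpaceTime → ℂ} (hF : Integrable F volume) (ξ σ : ℝ) :
    𝓕 (profile F ξ) σ = 𝓕 F (profilePoint σ ξ) := by
  rw [Real.fourier_real_eq]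
  simp only [smul_profile_eq]
  rw [← integral_prod _ (integrable_fourierChar_smul_toLp hF _), Real.fourier_eq,
    ← Measure.volume_eq_prod]
  exact (WithLp.volume_preserving_toLp ℝ ℝ).integral_comp
    (MeasurableEquiv.toLp 2 (ℝ × ℝ)).measurableEmbedding
    (fun z => Real.fourierChar (-inner ℝ z (profilePoint σ ξ)) • F z)

/-- The bound of the primitives of the profile provided by `enorm_intervalIntegral_le`. -/
def profileBound (F : SpaceTime → ℂ) (ξ : ℝ) : ℝ≥0∞ :=
  ∫⁻ σ : ℝ, ‖𝓕 F (profilePoint σ ξ)‖ₑ * bracketPow (-1) (2 * Real.pi * σ)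

theorem measurable_profilePoint : Measurable fun z : ℝ × ℝ => profilePoint z.1 z.2 := by
  unfold profilePoint
  fun_prop

/-- Cauchy–Schwarz in `σ` after writing `⟨ω⟩^{-1} = ⟨ω⟩^{-1/2-δ} ⟨ω⟩^{-1/2+δ}`. The first factor is
square integrable precisely because of the surplus `δ`, and the second is the Bourgain weight. -/
theorem lintegral_sq_profileBound_le (r : ℝ) {δ : ℝ} (hδ : 0 < δ) :
    ∃ C : ℝ≥0, ∀ F : SpaceTime → ℂ, Integrable F volume →
      ∫⁻ ξ : ℝ, (bracketPow r (2 * Real.pi * ξ) * profileBound F ξ) ^ 2 ≤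
        C * eLpNorm (fun ζ => (bourgainWeight r (-1 / 2 + δ) ζ : ℂ) * 𝓕 F ζ) 2 volume ^ 2 := by
  set I := ∫⁻ x, bracketPow (-(1 + 2 * δ)) x with hI
  have hI' : I < ∞ := lintegral_bracketPow_lt_top (by linarith)
  refine ⟨I.toNNReal, fun F hF => ?_⟩
  rw [ENNReal.coe_toNNReal hI'.ne, eLpNorm_two_sq]
  simp only [enorm_bourgainWeight_mul]
  have hcm := (continuous_fourier_of_integrable hF).measurable
  set G : SpaceTime → ℝ≥0∞ := fun ζ => ‖𝓕 F ζ‖ₑ with hG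
  have hGm : Measurable G := hcm.enorm
  have hPm : ∀ ξ, Measurable fun σ => profilePoint σ ξ := fun ξ =>
    measurable_profilePoint.comp measurable_prodMk_right
  rw [lintegral_spaceTime (by fun_prop), ← lintegral_const_mul' _ _ hI'.ne]
  refine lintegral_mono fun ξ => ?_
  have hGξ : Measurable fun σ => G (profilePoint σ ξ) := hGm.comp (hPm ξ)
  calc (bracketPow r (2 * Real.pi * ξ) * profileBound F ξ) ^ 2
      = (∫⁻ σ : ℝ, bracketPow (-(1 / 2 + δ)) (2 * Real.pi * σ) *
          (bracketPow r (2 * Real.pi * ξ) * (bracketPow (-1 / 2 + δ) (2 * Real.pi * σ) *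
            G (profilePoint σ ξ)))) ^ 2 := by
        rw [profileBound, ← lintegral_const_mul _ (by fun_prop)]
        congr 1
        refine lintegral_congr fun σ => ?_
        have h : bracketPow (-1) (2 * Real.pi * σ) = bracketPow (-(1 / 2 + δ)) (2 * Real.pi * σ) *
            bracketPow (-1 / 2 + δ) (2 * Real.pi * σ) := by
          rw [bracketPow_mul]
          congr 1
          ring
        rw [h, hG]
        ring
    _ ≤ (∫⁻ σ : ℝ, bracketPow (-(1 / 2 + δ)) (2 * Real.pi * σ) ^ 2) *
          ∫⁻ σ : ℝ, (bracketPow r (2 * Real.pi * ξ) * (bracketPow (-1 / 2 + δ) (2 * Real.pi * σ) *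
            G (profilePoint σ ξ))) ^ 2 :=
        sq_lintegral_mul_le (by fun_prop) (by fun_prop)
    _ ≤ I * ∫⁻ σ : ℝ, (bracketPow r (2 * Real.pi * ξ) *
          (bracketPow (-1 / 2 + δ) (2 * Real.pi * σ) * G (profilePoint σ ξ))) ^ 2 := by
        gcongr
        simp only [bracketPow_sq, show 2 * -(1 / 2 + δ) = -(1 + 2 * δ) by ring]
        exact lintegral_comp_two_pi_mul_le (by fun_prop)
    _ = _ := by
        congr 1
        -- The translation `σ = τ + 2πξ²` returns from modulation to time frequency.
        rw [← lintegral_sub_right_eq_self _ (-(2 * Real.pi * ξ ^ 2))]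
        refine lintegral_congr fun τ => ?_
        simp only [profilePoint, modulation, spatialFreq, toLp_fst, toLp_snd, sub_neg_eq_add,
          add_sub_cancel_right, one_mul]
        congr 4
        ring

theorem enorm_intervalIntegral_profile_le {F : SpaceTime → ℂ} (hF : Integrable F volume) {t T : ℝ}
    (ht : t ∈ Set.Icc 0 T) (ξ : ℝ) :
    ‖∫ t' in (0 : ℝ)..t, profile F ξ t'‖ₑ ≤ ENNReal.ofReal (T + 2) * profileBound F ξ := by
  refine (enorm_intervalIntegral_le ht.1 (integrable_profile hF ξ)).trans ?_
  simp only [fourier_profile hF, profileBound]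
  gcongr
  exact ht.2

theorem sobolevNorm_sq (s : ℝ) (f : Lp ℂ 2 (volume : Measure ℝ)) :
    sobolevNorm s f ^ 2 = ∫⁻ ξ : ℝ, (bracketPow s (2 * Real.pi * ξ) *
      ‖(𝓕 f : Lp ℂ 2 (volume : Measure ℝ)) ξ‖ₑ) ^ 2 := by
  rw [sobolevNorm, weightedFourierNorm_lp_two, eLpNorm_two_sq]
  simp only [enorm_mul, bracketPow_eq_enorm]

theorem fourier_freeEvolution (t : ℝ) (f : Lp ℂ 2 (volume : Measure ℝ)) :
    (𝓕 (freeEvolution t f) : Lp ℂ 2 (volume : Measure ℝ)) =ᵐ[volume]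
      fun ξ => freeSymbol t ξ * (𝓕 f : Lp ℂ 2 (volume : Measure ℝ)) ξ := by
  have h : 𝓕 (freeEvolution t f) = (memLp_freeSymbol_mul t (𝓕 f)).toLp _ :=
    fourier_fourierInv_eq _
  rw [h]
  exact MemLp.coeFn_toLp _

theorem fourier_lp_two_sub (f g : Lp ℂ 2 (volume : Measure ℝ)) :
    (𝓕 (f - g) : Lp ℂ 2 (volume : Measure ℝ)) =ᵐ[volume]
      fun ξ => (𝓕 f : Lp ℂ 2 (volume : Measure ℝ)) ξ - (𝓕 g : Lp ℂ 2 (volume : Measure ℝ)) ξ := by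
  have h : 𝓕 (f - g) = (𝓕 f - 𝓕 g : Lp ℂ 2 (volume : Measure ℝ)) := by
    rw [sub_eq_add_neg, FourierTransform.fourier_add, FourierTransform.fourier_neg, ← sub_eq_add_neg]
  rw [h]
  exact Lp.coeFn_sub _ _

/-- The Fourier transform of the nonlinear part of a mild solution. -/
theorem fourier_mildSolution_sub_freeEvolution {μ T : ℝ} {u₀ : Lp ℂ 2 (volume : Measure ℝ)}
    {u : ℝ → Lp ℂ 2 (volume : Measure ℝ)} {v : Lp ℂ 2 (volume : Measure SpaceTime)}
    (huv : AgreesOn T u v) (hu : IsMildSolution μ T u₀ u) {t : ℝ} (ht : t ∈ Set.Icc 0 T) :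
    (𝓕 (u t - freeEvolution t u₀) : Lp ℂ 2 (volume : Measure ℝ)) =ᵐ[volume] fun ξ =>
      -(Complex.I * μ) *
        (freeSymbol t ξ * ∫ t' in (0 : ℝ)..t, profile (fun z => quintic (v z)) ξ t') := by
  filter_upwards [fourier_lp_two_sub (u t) (freeEvolution t u₀), fourier_freeEvolution t u₀,
    hu.duhamel t ht] with ξ h1 h2 h3
  have h4 : ∫ t' in (0 : ℝ)..t, freeSymbol (t - t') ξ *
      (𝓕 (fun x => quintic (u t' x)) : ℝ → ℂ) ξ =
      freeSymbol t ξ * ∫ t' in (0 : ℝ)..t, profile (fun z => quintic (v z)) ξ t' := by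
    rw [← intervalIntegral.integral_const_mul]
    -- Inside `[0, t]` the curve may be replaced by `v` at almost every time. The nonlinearity of
    -- `v` is integrable on all of space-time, so no time cutoff is needed.
    refine intervalIntegral.integral_congr_ae ?_
    filter_upwards [huv] with t' ht' hm
    rw [Set.uIoc_of_le ht.1] at hm
    have h5 : (fun x => quintic (u t' x)) =ᵐ[volume]
        fun x => quintic (v (WithLp.toLp 2 (t', x))) := by
      filter_upwards [ht' ⟨hm.1.le, hm.2.trans ht.2⟩] with x hx
      rw [hx]
    rw [freeSymbol_sub, profile, Real.fourier_congr_ae h5, mul_assoc]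
  rw [h1, h2, h3, h4]
  ring

end Profile

/-! ### Bound and continuity of the nonlinear part -/

section Smoothing

variable {μ T : ℝ} {u₀ : Lp ℂ 2 (volume : Measure ℝ)} {u : ℝ → Lp ℂ 2 (volume : Measure ℝ)}
  {v : Lp ℂ 2 (volume : Measure SpaceTime)}

theorem enorm_freeSymbol_mul (t ξ : ℝ) (z : ℂ) : ‖freeSymbol t ξ * z‖ₑ = ‖z‖ₑ := by
  rw [enorm_mul, ← ofReal_norm, norm_freeSymbol, ENNReal.ofReal_one, one_mul]

theorem enorm_neg_I_mul_mul (hμ : μ = 1 ∨ μ = -1) (z : ℂ) : ‖-(Complex.I * μ) * z‖ₑ = ‖z‖ₑ := by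
  have h : ‖-(Complex.I * μ)‖ = 1 := by
    rcases hμ with rfl | rfl <;> simp
  rw [enorm_mul, ← ofReal_norm, h, ENNReal.ofReal_one, one_mul]

theorem sq_sobolevNorm_sub_freeEvolution_le (hμ : μ = 1 ∨ μ = -1) (huv : AgreesOn T u v)
    (hu : IsMildSolution μ T u₀ u) (hF : Integrable (fun z => quintic (v z)) volume) (r : ℝ) {t : ℝ}
    (ht : t ∈ Set.Icc 0 T) :
    sobolevNorm r (u t - freeEvolution t u₀ : Lp ℂ 2 (volume : Measure ℝ)) ^ 2 ≤
      ENNReal.ofReal (T + 2) ^ 2 *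
        ∫⁻ ξ : ℝ, (bracketPow r (2 * Real.pi * ξ) * profileBound (fun z => quintic (v z)) ξ) ^ 2 := by
  rw [sobolevNorm_sq, ← lintegral_const_mul' _ _ (by simp)]
  refine lintegral_mono_ae ?_
  filter_upwards [fourier_mildSolution_sub_freeEvolution huv hu ht] with ξ hξ
  rw [hξ, enorm_neg_I_mul_mul hμ, enorm_freeSymbol_mul, ← mul_pow, mul_left_comm]
  gcongr
  exact enorm_intervalIntegral_profile_le hF ht ξ

/-- The nonlinear part of a mild solution is continuous in `H^r`, by dominated convergence. -/
theorem tendsto_sobolevNorm_sub_freeEvolution (hμ : μ = 1 ∨ μ = -1) (huv : AgreesOn T u v)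
    (hu : IsMildSolution μ T u₀ u) (hF : Integrable (fun z => quintic (v z)) volume) {r : ℝ}
    (hfin : ∫⁻ ξ : ℝ, (bracketPow r (2 * Real.pi * ξ) *
      profileBound (fun z => quintic (v z)) ξ) ^ 2 ≠ ∞) {t₀ : ℝ} (ht₀ : t₀ ∈ Set.Icc 0 T) :
    Tendsto (fun t => sobolevNorm r
        ((u t - freeEvolution t u₀) - (u t₀ - freeEvolution t₀ u₀) : Lp ℂ 2 (volume : Measure ℝ)))
      (𝓝[Set.Icc 0 T] t₀) (𝓝 0) := by
  set F : SpaceTime → ℂ := fun z => quintic (v z) with hFd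
  set D : ℝ → ℝ → ℂ := fun t ξ => freeSymbol t ξ * ∫ t' in (0 : ℝ)..t, profile F ξ t' with hD
  set W : ℝ → Lp ℂ 2 (volume : Measure ℝ) := fun t => u t - freeEvolution t u₀ with hW
  have hDW : ∀ t ∈ Set.Icc 0 T, (fun ξ => bracketPow r (2 * Real.pi * ξ) *
      ‖(𝓕 (W t - W t₀) : Lp ℂ 2 (volume : Measure ℝ)) ξ‖ₑ) =ᵐ[volume]
      fun ξ => bracketPow r (2 * Real.pi * ξ) * ‖D t ξ - D t₀ ξ‖ₑ := fun t ht => by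
    filter_upwards [fourier_lp_two_sub (W t) (W t₀),
      fourier_mildSolution_sub_freeEvolution huv hu ht,
      fourier_mildSolution_sub_freeEvolution huv hu ht₀] with ξ h1 h2 h3
    rw [h1, h2, h3, ← mul_sub, enorm_neg_I_mul_mul hμ]
  have hDb : ∀ t ∈ Set.Icc 0 T, ∀ ξ, ‖D t ξ‖ₑ ≤ ENNReal.ofReal (T + 2) * profileBound F ξ :=
    fun t ht ξ => by
      rw [enorm_freeSymbol_mul]
      exact enorm_intervalIntegral_profile_le hF ht ξ
  have hDc : ∀ ξ, Continuous fun t => D t ξ := fun ξ =>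
    (continuous_freeSymbol ξ).mul (intervalIntegral.continuous_primitive
      (fun _ _ => (integrable_profile hF ξ).intervalIntegrable) 0)
  have hmem : ∀ᶠ t in 𝓝[Set.Icc 0 T] t₀, t ∈ Set.Icc 0 T := self_mem_nhdsWithin
  have hlim : Tendsto (fun t => ∫⁻ ξ : ℝ, (bracketPow r (2 * Real.pi * ξ) *
      ‖D t ξ - D t₀ ξ‖ₑ) ^ 2) (𝓝[Set.Icc 0 T] t₀) (𝓝 (∫⁻ _ : ℝ, 0)) := by
    -- Both `D t` and `D t₀` are below `(T + 2)` times `profileBound`, independently of time, whence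
    -- the factor `2 (T + 2)` in the majorant.
    refine tendsto_lintegral_filter_of_dominated_convergence' (fun ξ => (2 * ENNReal.ofReal (T + 2)) ^ 2 *
      (bracketPow r (2 * Real.pi * ξ) * profileBound F ξ) ^ 2) ?_ ?_ ?_ ?_
    · filter_upwards [hmem] with t ht
      refine AEMeasurable.pow_const (AEMeasurable.congr ?_ (hDW t ht)) 2
      have := (Lp.stronglyMeasurable (𝓕 (W t - W t₀) : Lp ℂ 2 (volume : Measure ℝ))).measurable
      fun_prop
    · filter_upwards [hmem] with t ht
      refine Eventually.of_forall fun ξ => ?_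
      rw [← mul_pow, mul_left_comm]
      gcongr
      refine (enorm_sub_le).trans ((add_le_add (hDb t ht ξ) (hDb t₀ ht₀ ξ)).trans (le_of_eq ?_))
      ring
    · rw [lintegral_const_mul' _ _ (by finiteness)]
      finiteness
    · refine Eventually.of_forall fun ξ => ?_
      have h1 : Tendsto (fun t => ‖D t ξ - D t₀ ξ‖ₑ) (𝓝[Set.Icc 0 T] t₀) (𝓝 0) := by
        have h := (((hDc ξ).sub continuous_const).enorm.tendsto' t₀ 0
          (by simp : ‖D t₀ ξ - D t₀ ξ‖ₑ = 0))
        exact h.mono_left nhdsWithin_le_nhds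
      have h2 := ENNReal.Tendsto.pow (n := 2) (ENNReal.Tendsto.const_mul
        (a := bracketPow r (2 * Real.pi * ξ)) h1 (Or.inr ENNReal.ofReal_ne_top))
      simpa using h2
  rw [lintegral_zero] at hlim
  have hsq : Tendsto (fun t => sobolevNorm r (W t - W t₀ : Lp ℂ 2 (volume : Measure ℝ)) ^ 2)
      (𝓝[Set.Icc 0 T] t₀) (𝓝 0) := by
    refine hlim.congr' ?_
    filter_upwards [hmem] with t ht
    rw [sobolevNorm_sq]
    refine (lintegral_congr_ae ?_).symm
    filter_upwards [hDW t ht] with ξ hξ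
    rw [hξ]
  have h := (ENNReal.continuous_rpow_const (y := 1 / 2)).tendsto 0 |>.comp hsq
  rw [ENNReal.zero_rpow_of_pos (by norm_num)] at h
  refine h.congr fun t => ?_
  rw [Function.comp_apply, ← ENNReal.rpow_natCast, ← ENNReal.rpow_mul]
  norm_num [hW]

end Smoothing

theorem nonlinear_smoothing {s a : ℝ} (hs : 1 / 3 < s) (ha : a < min (3 * s - 1) (1 / 2)) {ε : ℝ}
    (hε : 0 < ε) (T : ℝ) :
    ∃ C : ℝ≥0, ∀ μ : ℝ, (μ = 1 ∨ μ = -1) →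
      ∀ (u₀ : Lp ℂ 2 (volume : Measure ℝ)) (u : ℝ → Lp ℂ 2 (volume : Measure ℝ))
        (v : Lp ℂ 2 (volume : Measure SpaceTime)), bourgainNorm s (1 / 2 + ε) v ≠ ∞ →
        AgreesOn T u v → IsMildSolution μ T u₀ u →
        (∀ t ∈ Set.Icc 0 T,
          sobolevNorm (s + a) (u t - freeEvolution t u₀ : Lp ℂ 2 (volume : Measure ℝ)) ≤
            C * bourgainNorm s (1 / 2 + ε) v ^ 5) ∧
        ∀ t₀ ∈ Set.Icc 0 T,
          Tendsto (fun t => sobolevNorm (s + a)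
              ((u t - freeEvolution t u₀) - (u t₀ - freeEvolution t₀ u₀) :
                Lp ℂ 2 (volume : Measure ℝ)))
            (𝓝[Set.Icc 0 T] t₀) (𝓝 0) := by
  obtain ⟨δ₀, hδ₀, h⟩ := eLpNorm_bourgainWeight_fourier_quintic_le hs ha
  -- The smoothing statement contains no `δ`, so any admissible value serves; the midpoint is taken.
  obtain ⟨C₁, hC₁⟩ := h (δ₀ / 2) (by linarith) (by linarith) ε hε
  obtain ⟨C₂, hC₂⟩ := lintegral_sq_profileBound_le (s + a) (half_pos hδ₀)
  refine ⟨(T + 2).toNNReal * (NNReal.sqrt C₂ * C₁), fun μ hμ u₀ u v hv huv hu => ?_⟩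
  obtain ⟨hF, hle⟩ := hC₁ v hv
  have hB : ∫⁻ ξ : ℝ, (bracketPow (s + a) (2 * Real.pi * ξ) *
      profileBound (fun z => quintic (v z)) ξ) ^ 2 ≤
      C₂ * (C₁ * bourgainNorm s (1 / 2 + ε) v ^ 5) ^ 2 := by
    refine (hC₂ _ hF).trans ?_
    gcongr
  refine ⟨fun t ht => ?_, fun t₀ ht₀ => tendsto_sobolevNorm_sub_freeEvolution hμ huv hu hF
    (ne_top_of_le_ne_top (by finiteness) hB) ht₀⟩
  rw [← ENNReal.pow_le_pow_left_iff two_ne_zero]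
  refine (sq_sobolevNorm_sub_freeEvolution_le hμ huv hu hF (s + a) ht).trans
    ((mul_le_mul' le_rfl hB).trans (le_of_eq ?_))
  have hsq : (C₂ : ℝ≥0∞) = (NNReal.sqrt C₂ : ℝ≥0∞) ^ 2 := by
    rw [← ENNReal.coe_pow, NNReal.sq_sqrt]
  rw [hsq, ENNReal.ofReal]
  push_cast
  ring

end QuinticNLS

end

theorem mainTheorem7 (s a : ℝ) (hs : 1 / 3 < s) (ha : a < min (3 * s - 1) (1 / 2)) :
    -- the multilinear estimate
    (∃ δ₀ : ℝ, 0 < δ₀ ∧ ∀ δ : ℝ, 0 < δ → δ < δ₀ → ∀ ε : ℝ, 0 < ε → ∃ C : ℝ≥0,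
      ∀ u : Lp ℂ 2 (volume : Measure QuinticNLS.SpaceTime),
        QuinticNLS.bourgainNorm s (1 / 2 + ε) u ≠ ∞ →
        ∃ hu : MemLp (fun z => QuinticNLS.quintic (u z)) 1 volume,
          QuinticNLS.bourgainNorm (s + a) (-1 / 2 + δ) (hu.toLp _) ≤
            C * QuinticNLS.bourgainNorm s (1 / 2 + ε) u ^ 5) ∧
    -- the nonlinear smoothing
    (∀ ε : ℝ, 0 < ε → ∀ T : ℝ, 0 < T → ∃ C : ℝ≥0, ∀ μ : ℝ, (μ = 1 ∨ μ = -1) →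
      ∀ (u₀ : Lp ℂ 2 (volume : Measure ℝ)) (u : ℝ → Lp ℂ 2 (volume : Measure ℝ))
        (v : Lp ℂ 2 (volume : Measure QuinticNLS.SpaceTime)),
        QuinticNLS.sobolevNorm s u₀ ≠ ∞ →
        QuinticNLS.bourgainNorm s (1 / 2 + ε) v ≠ ∞ →
        QuinticNLS.AgreesOn T u v →
        QuinticNLS.IsMildSolution μ T u₀ u →
        (∀ t ∈ Set.Icc 0 T,
          QuinticNLS.sobolevNorm (s + a)
              (u t - QuinticNLS.freeEvolution t u₀ : Lp ℂ 2 (volume : Measure ℝ)) ≤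
            C * QuinticNLS.bourgainNorm s (1 / 2 + ε) v ^ 5) ∧
        ∀ t₀ ∈ Set.Icc 0 T,
          Tendsto (fun t => QuinticNLS.sobolevNorm (s + a)
              ((u t - QuinticNLS.freeEvolution t u₀) - (u t₀ - QuinticNLS.freeEvolution t₀ u₀) :
                Lp ℂ 2 (volume : Measure ℝ)))
            (𝓝[Set.Icc 0 T] t₀) (𝓝 0)) := by
  refine ⟨QuinticNLS.bourgainNorm_quintic_le hs ha, fun ε hε T _ => ?_⟩
  obtain ⟨C, hC⟩ := QuinticNLS.nonlinear_smoothing hs ha hε T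
  exact ⟨C, fun μ hμ u₀ u v _ hv huv hu => hC μ hμ u₀ u v hv huv hu⟩
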